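/- Let $a=(a_\ell)_{\ell\in\mathbb Z}$ be a finitely supported complex sequence with $\sum_{\ell\in\mathbb Z}a_\ell=1$, and let $\widehat F_a(\theta):=\sum_{\ell\in\mathbb Z}a_\ell\,e^{i\ell\theta}$ for $\theta\in\mathbb C$. Assume that $|\widehat F_a(\theta)|<1$ for all real $\theta\in[-\pi,\pi]\setminus\{0\}$, and that there are real numbers $\alpha$, $c_3$, $c_4$ with $c_3>0$ and $c_4>0$ and a function $\varphi$, holomorphic on a neighborhood of $0$ in $\mathbb C$, such that, for all $\theta\in\mathbb C$ close to $0$, $$\widehat F_a(\theta)=\exp\left(i\alpha\theta-i c_3\theta^3-c_4\theta^4+\theta^5\varphi(\theta)\right).$$ Let $L_a$ be the convolution operator $(L_a u)_j:=\sum_{\ell\in\mathbb Z}a_\ell\,u_{j-\ell}$, let $\boldsymbol\delta$ be the sequence with $\boldsymbol\delta_0=1$ and $\boldsymbol\delta_j=0$ for $j\neq0$, and let $\mathcal G_j^n:=(L_a^n\boldsymbol\delta)_j$ for $n\in\mathbb N$, $j\in\mathbb Z$. Then $\sum_{j\in\mathbb Z}|\mathcal G_j^n|$ converges for every $n$, and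 $$\lim_{n\to+\infty}\frac{1}{n^{1/8}}\sum_{j\in\mathbb Z}\left|\mathcal G_j^n\right|=\frac{8\,\Gamma(11/8)}{\sqrt3\,\pi^{3/2}}\,\frac{c_3^{1/2}}{c_4^{3/8}}.$$ Consequently, the operator norm of $L_a^n$ on the Banach space $\ell^\infty(\mathbb Z;\mathbb C)$ of bounded sequences satisfies $$\lim_{n\to+\infty}\frac{1}{n^{1/8}}\left\|L_a^n\right\|_{\ell^\infty\to\ell^\infty}=\frac{8\,\Gamma(11/8)}{\sqrt3\,\pi^{3/2}}\,\frac{c_3^{1/2}}{c_4^{3/8}}.$$ -/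

import Mathlib

open scoped ENNReal

noncomputable section

/-- The Laurent (convolution) operator `L_a : u ↦ a ⋆ u` on complex sequences indexed by `ℤ`,
`(L_a u)_j = ∑_ℓ a_ℓ u_{j-ℓ}`, for a finitely supported sequence `a`. -/
def laurentOp (a : ℤ →₀ ℂ) : Module.End ℂ (ℤ → ℂ) where
  toFun u := fun j => ∑ l ∈ a.support, a l * u (j - l)
  map_add' u v := by
    funext j
    simp [mul_add, Finset.sum_add_distrib]
  map_smul' c u := by
    funext j
    simp only [Pi.smul_apply, smul_eq_mul, RingHom.id_apply, Finset.mul_sum]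
    exact Finset.sum_congr rfl fun l _ => by ring

/-- The discrete Dirac mass at `0`. -/
def diracSeq : ℤ → ℂ := fun j => if j = 0 then 1 else 0

/-- The Green's function `G_j^n = (L_a^n δ)_j`. -/
def greenFunction (a : ℤ →₀ ℂ) (n : ℕ) (j : ℤ) : ℂ := (laurentOp a ^ n) diracSeq j

/-- The Fourier transform `∑_ℓ a_ℓ e^{iℓθ}` of `a`, a trigonometric polynomial, for complex `θ`. -/
def fourierSymbol (a : ℤ →₀ ℂ) (θ : ℂ) : ℂ :=
  ∑ l ∈ a.support, a l * Complex.exp (Complex.I * (l : ℂ) * θ)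

/-- The standing assumption on a finitely supported sequence `a`: it sums to `1`, its Fourier
transform is dissipative, and the logarithm of the Fourier transform has the stated expansion at
`0`, with a holomorphic remainder. -/
structure DispersiveAssumption (a : ℤ →₀ ℂ) (α c₃ c₄ : ℝ) : Prop where
  sum_eq_one : ∑ l ∈ a.support, a l = 1
  dissipation : ∀ θ : ℝ, θ ∈ Set.Icc (-Real.pi) Real.pi → θ ≠ 0 → ‖fourierSymbol a (θ : ℂ)‖ < 1
  c₃_ne_zero : c₃ ≠ 0
  c₄_pos : 0 < c₄
  expansion : ∃ (φ : ℂ → ℂ) (U : Set ℂ), IsOpen U ∧ (0 : ℂ) ∈ U ∧ DifferentiableOn ℂ φ U ∧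
    ∀ θ ∈ U, fourierSymbol a θ =
      Complex.exp (Complex.I * (α : ℂ) * θ - Complex.I * (c₃ : ℂ) * θ ^ 3 - (c₄ : ℂ) * θ ^ 4
        + θ ^ 5 * φ θ)

theorem laurentOp_norm_le (a : ℤ →₀ ℂ) (u : lp (fun _ : ℤ => ℂ) ∞) (j : ℤ) :
    ‖laurentOp a (⇑u) j‖ ≤ (∑ l ∈ a.support, ‖a l‖) * ‖u‖ := by
  rw [Finset.sum_mul]
  refine (norm_sum_le _ _).trans (Finset.sum_le_sum fun l _ => ?_)
  rw [norm_mul]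
  exact mul_le_mul_of_nonneg_left (lp.norm_apply_le_norm ENNReal.top_ne_zero u _) (norm_nonneg _)

/-- The operator `L_a` acting boundedly on the Banach space `ℓ^∞(ℤ; ℂ)`. -/
def laurentLinfty (a : ℤ →₀ ℂ) :
    lp (fun _ : ℤ => ℂ) ∞ →L[ℂ] lp (fun _ : ℤ => ℂ) ∞ :=
  LinearMap.mkContinuous
    { toFun := fun u => ⟨laurentOp a (⇑u), memℓp_infty
        ⟨(∑ l ∈ a.support, ‖a l‖) * ‖u‖, by
          rintro _ ⟨j, rfl⟩
          exact laurentOp_norm_le a u j⟩⟩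
      map_add' := fun u v => by
        apply Subtype.ext
        exact (laurentOp a).map_add (⇑u) (⇑v)
      map_smul' := fun c u => by
        apply Subtype.ext
        exact (laurentOp a).map_smul c (⇑u) }
    (∑ l ∈ a.support, ‖a l‖)
    (fun u => lp.norm_le_of_forall_le
      (mul_nonneg (Finset.sum_nonneg fun _ _ => norm_nonneg _) (norm_nonneg _))
      (laurentOp_norm_le a u))

end

/-! The sequence `convPow a n` is the Green's function, and the norm of its convolution operator on
bounded sequences is its ℓ¹ norm, so both limits are one statement about `∑ ‖convPow a n j‖`. Its
entries are the Fourier coefficients of the n-th power of the symbol. With `l = n^{1/4}`, `θ = t /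
l` and `z = (αn - j) / l²`, the leading part of the exponent turns the j-th coefficient into
`(2πl)⁻¹ ∫ exp(-il(c₃t³ - zt) - c₄t⁴) dt`, with an error `O(l⁻²)` uniform in j
(`norm_convPow_sub_oscInt_le`). The large parameter `l` enters the phase only.

For `z > 0` the phase has stationary points `±s`, `s = √(z / (3c₃))`, with conjugate contributions.
Stationary phase (`norm_integral_Ioi_oscKernel_sub_le`) gives the modulus `l^{-1/2} A(z) |cos(2c₃s³l
- π/4)|` with `A = profileAmp c₃ c₄`. The points z are spaced by `l⁻²`, while the cosine oscillates
on the scale `l⁻¹`: the sum over j is thus close to `l²` times an integral, in which `|cos|` may be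
replaced by its mean `2/π`. Hence the range `e ≤ z ≤ M` contributes about `√l · π⁻² ∫ A`, and `√l =
n^{1/8}`. Since `A` is a constant times `z^{-1/4} exp(-(c₄/(9c₃²)) z²)`, its integral over the
half-line is a Gamma value, which produces the constant.

The other indices are negligible against `√l`. For `-M ≤ z ≤ -e` there is no stationary point, each
entry is `O(l⁻²)`, and the sum is bounded. For `|z| ≤ e` and `|z| ≥ M`, where the pointwise
asymptotics are not uniform, Cauchy–Schwarz is used with the plain and the weighted ℓ² bounds, which
Parseval gives from the symbol and its derivative; the resulting contributions are `√l` times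
`O(√e)` and `O(M^{-1/2})`. The limit `n → ∞` is taken first, then `e = M⁻¹ → 0`. -/

noncomputable section

open MeasureTheory Set Filter Topology

/-! ### Powers of the convolution operator -/

/-- The `n`-fold convolution power of a finitely supported sequence. -/
def convPow (a : ℤ →₀ ℂ) (n : ℕ) : ℤ →₀ ℂ :=
  ((AddMonoidAlgebra.ofCoeff a : AddMonoidAlgebra ℂ ℤ) ^ n).coeff

/-- The action of `ℤ` on sequences by translation. -/
def shiftHom : Multiplicative ℤ →* Module.End ℂ (ℤ → ℂ) where
  toFun m :=
    { toFun := fun u j => u (j - m.toAdd)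
      map_add' := fun _ _ => rfl
      map_smul' := fun _ _ => rfl }
  map_one' := by
    ext u j
    simp
  map_mul' m k := by
    refine LinearMap.ext fun u => funext fun j => ?_
    change u (j - (m.toAdd + k.toAdd)) = u (j - m.toAdd - k.toAdd)
    rw [sub_sub]

/-- The character `ℓ ↦ e^{iℓθ}` of `ℤ`. -/
def charHom (θ : ℂ) : Multiplicative ℤ →* ℂ where
  toFun m := Complex.exp (Complex.I * (m.toAdd : ℂ) * θ)
  map_one' := by simp
  map_mul' m k := by
    rw [← Complex.exp_add]
    congr 1
    push_cast [toAdd_mul]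
    ring

/-- Finitely supported sequences under convolution form the group algebra of `ℤ`. Both `laurentOp`
and `fourierSymbol` at a point are lifts of a monoid homomorphism to this algebra, hence
multiplicative; this is what identifies their n-th powers. -/
theorem laurentOp_eq_lift (f : AddMonoidAlgebra ℂ ℤ) :
    laurentOp f.coeff = AddMonoidAlgebra.lift ℂ (Module.End ℂ (ℤ → ℂ)) ℤ shiftHom f := by
  rw [AddMonoidAlgebra.lift_apply]
  refine LinearMap.ext fun u => funext fun j => ?_
  simp only [Finsupp.sum, LinearMap.sum_apply, Finset.sum_apply]
  rfl

theorem fourierSymbol_eq_lift (f : AddMonoidAlgebra ℂ ℤ) (θ : ℂ) :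
    fourierSymbol f.coeff θ = AddMonoidAlgebra.lift ℂ ℂ ℤ (charHom θ) f := by
  rw [AddMonoidAlgebra.lift_apply]
  rfl

theorem laurentOp_pow (a : ℤ →₀ ℂ) (n : ℕ) : laurentOp a ^ n = laurentOp (convPow a n) := by
  have h := laurentOp_eq_lift (AddMonoidAlgebra.ofCoeff a)
  rw [AddMonoidAlgebra.coeff_ofCoeff] at h
  rw [convPow, laurentOp_eq_lift (_ ^ n), map_pow, h]

theorem fourierSymbol_convPow (a : ℤ →₀ ℂ) (n : ℕ) (θ : ℂ) :
    fourierSymbol (convPow a n) θ = fourierSymbol a θ ^ n := by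
  have h := fourierSymbol_eq_lift (AddMonoidAlgebra.ofCoeff a) θ
  rw [AddMonoidAlgebra.coeff_ofCoeff] at h
  rw [convPow, fourierSymbol_eq_lift (_ ^ n), map_pow, h]

theorem laurentOp_diracSeq (b : ℤ →₀ ℂ) : laurentOp b diracSeq = b := by
  funext j
  change ∑ l ∈ b.support, b l * diracSeq (j - l) = b j
  rw [Finset.sum_eq_single j]
  · simp [diracSeq]
  · intro l _ hl
    simp [diracSeq, sub_eq_zero, hl.symm]
  · intro h
    simp [Finsupp.notMem_support_iff.mp h]

theorem greenFunction_eq (a : ℤ →₀ ℂ) (n : ℕ) (j : ℤ) :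
    greenFunction a n j = convPow a n j := by
  rw [greenFunction, laurentOp_pow, laurentOp_diracSeq]

theorem coe_laurentLinfty_pow (a : ℤ →₀ ℂ) (n : ℕ) (u : lp (fun _ : ℤ => ℂ) ∞) :
    (((laurentLinfty a ^ n) u : lp (fun _ : ℤ => ℂ) ∞) : ℤ → ℂ) = (laurentOp a ^ n) u := by
  induction n generalizing u with
  | zero => rfl
  | succ n ih =>
    rw [pow_succ, pow_succ]
    exact ih (laurentLinfty a u)

theorem norm_laurentLinfty (b : ℤ →₀ ℂ) : ‖laurentLinfty b‖ = ∑ l ∈ b.support, ‖b l‖ := by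
  have hnn : 0 ≤ ∑ l ∈ b.support, ‖b l‖ := Finset.sum_nonneg fun _ _ => norm_nonneg _
  refine le_antisymm (LinearMap.mkContinuous_norm_le _ hnn _) ?_
  -- The value at index 0 pairs `b l` with `u (-l)`, so the extremal sequence is the reflected
  -- conjugate phase of `b`, set to 0 where `b` vanishes.
  let u : ℤ → ℂ := fun j => (SignType.sign ‖b (-j)‖ : ℂ) * (starRingEnd ℂ) (b (-j)) / ‖b (-j)‖
  have hu : ∀ j, ‖u j‖ ≤ 1 := by
    intro j
    by_cases h : b (-j) = 0
    · simp [u, h]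
    · have h' : 0 < ‖b (-j)‖ := norm_pos_iff.mpr h
      simp [u, sign_pos h', h]
  let U : lp (fun _ : ℤ => ℂ) ∞ := ⟨u, memℓp_infty ⟨1, by rintro _ ⟨j, rfl⟩; exact hu j⟩⟩
  have hU : ‖U‖ ≤ 1 := lp.norm_le_of_forall_le zero_le_one hu
  have h0 : (laurentLinfty b U : ℤ → ℂ) 0 = ((∑ l ∈ b.support, ‖b l‖ : ℝ) : ℂ) := by
    change ∑ l ∈ b.support, b l * u (0 - l) = _
    push_cast
    refine Finset.sum_congr rfl fun l hl => ?_
    have h' : 0 < ‖b l‖ := norm_pos_iff.mpr (Finsupp.mem_support_iff.mp hl)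
    have h'' : (‖b l‖ : ℂ) ≠ 0 := by exact_mod_cast h'.ne'
    simp only [u, zero_sub, neg_neg, sign_pos h']
    rw [mul_div_assoc', div_eq_iff h'']
    have := Complex.mul_conj' (b l)
    simp only [SignType.coe_one, one_mul]
    rw [this]
    ring
  calc ∑ l ∈ b.support, ‖b l‖ = ‖(laurentLinfty b U : ℤ → ℂ) 0‖ := by
        rw [h0, Complex.norm_real, Real.norm_of_nonneg hnn]
    _ ≤ ‖laurentLinfty b U‖ := lp.norm_apply_le_norm ENNReal.top_ne_zero _ _
    _ ≤ ‖laurentLinfty b‖ * ‖U‖ := (laurentLinfty b).le_opNorm U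
    _ ≤ ‖laurentLinfty b‖ * 1 := by gcongr
    _ = ‖laurentLinfty b‖ := mul_one _

theorem laurentLinfty_pow (a : ℤ →₀ ℂ) (n : ℕ) :
    laurentLinfty a ^ n = laurentLinfty (convPow a n) := by
  refine ContinuousLinearMap.ext fun u => Subtype.ext ?_
  rw [coe_laurentLinfty_pow, laurentOp_pow]
  rfl

theorem tsum_norm_greenFunction (a : ℤ →₀ ℂ) (n : ℕ) :
    ∑' j : ℤ, ‖greenFunction a n j‖ = ∑ j ∈ (convPow a n).support, ‖convPow a n j‖ := by
  simp only [greenFunction_eq]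
  exact tsum_eq_sum fun j hj => by simp [Finsupp.notMem_support_iff.mp hj]

theorem summable_norm_greenFunction (a : ℤ →₀ ℂ) (n : ℕ) :
    Summable fun j : ℤ => ‖greenFunction a n j‖ := by
  simp only [greenFunction_eq]
  exact summable_of_ne_finset_zero (s := (convPow a n).support)
    fun j hj => by simp [Finsupp.notMem_support_iff.mp hj]

/-! ### Fourier coefficients and Parseval's identity -/

theorem continuous_fourierSymbol (b : ℤ →₀ ℂ) : Continuous (fourierSymbol b) := by
  unfold fourierSymbol
  fun_prop

theorem integral_exp_int_mul (m : ℤ) :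
    ∫ θ in (-Real.pi)..Real.pi, Complex.exp (Complex.I * (m : ℂ) * (θ : ℂ)) =
      if m = 0 then (2 * Real.pi : ℂ) else 0 := by
  split_ifs with h
  · subst h
    simp
    ring
  · have hc : Complex.I * (m : ℂ) ≠ 0 := by simp [h]
    rw [integral_exp_mul_complex hc]
    have : Complex.exp (Complex.I * m * (Real.pi : ℝ)) =
        Complex.exp (Complex.I * m * ((-Real.pi : ℝ) : ℂ)) := by
      rw [Complex.exp_eq_exp_iff_exists_int]
      exact ⟨m, by push_cast; ring⟩
    rw [this, sub_self, zero_div]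

theorem integral_fourierSymbol_mul_exp (b : ℤ →₀ ℂ) (j : ℤ) :
    ∫ θ in (-Real.pi)..Real.pi,
      fourierSymbol b (θ : ℂ) * Complex.exp (-(Complex.I * (j : ℂ) * (θ : ℂ))) =
      2 * Real.pi * b j := by
  have h1 : ∀ θ : ℝ, fourierSymbol b (θ : ℂ) * Complex.exp (-(Complex.I * (j : ℂ) * (θ : ℂ))) =
      ∑ l ∈ b.support, b l * Complex.exp (Complex.I * ((l - j : ℤ) : ℂ) * (θ : ℂ)) := by
    intro θ
    rw [fourierSymbol, Finset.sum_mul]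
    refine Finset.sum_congr rfl fun l _ => ?_
    rw [mul_assoc, ← Complex.exp_add]
    congr 2
    push_cast
    ring
  simp only [h1]
  rw [intervalIntegral.integral_finsetSum]
  · simp only [intervalIntegral.integral_const_mul, integral_exp_int_mul, sub_eq_zero]
    rw [Finset.sum_eq_single j]
    · simp
      ring
    · intro l _ hl
      simp [hl]
    · intro h
      simp [Finsupp.notMem_support_iff.mp h]
  · intro l _
    apply Continuous.intervalIntegrable
    fun_prop

theorem integral_norm_fourierSymbol_sq (b : ℤ →₀ ℂ) :
    ∫ θ in (-Real.pi)..Real.pi, ‖fourierSymbol b (θ : ℂ)‖ ^ 2 =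
      2 * Real.pi * ∑ j ∈ b.support, ‖b j‖ ^ 2 := by
  -- Only the conjugate factor is expanded; the other one is then integrated against characters by
  -- the coefficient formula.
  have h1 : ∀ θ : ℝ, ((‖fourierSymbol b (θ : ℂ)‖ ^ 2 : ℝ) : ℂ) =
      ∑ l ∈ b.support, (starRingEnd ℂ) (b l) *
        (fourierSymbol b (θ : ℂ) * Complex.exp (-(Complex.I * (l : ℂ) * (θ : ℂ)))) := by
    intro θ
    push_cast
    rw [← Complex.mul_conj', fourierSymbol, map_sum, Finset.mul_sum]
    refine Finset.sum_congr rfl fun l _ => ?_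
    rw [map_mul, ← Complex.exp_conj]
    have : (starRingEnd ℂ) (Complex.I * (l : ℂ) * (θ : ℂ)) = -(Complex.I * (l : ℂ) * (θ : ℂ)) := by
      simp
    rw [this]
    ring
  have h2 : ((∫ θ in (-Real.pi)..Real.pi, ‖fourierSymbol b (θ : ℂ)‖ ^ 2 : ℝ) : ℂ) =
      ((2 * Real.pi * ∑ j ∈ b.support, ‖b j‖ ^ 2 : ℝ) : ℂ) := by
    rw [← intervalIntegral.integral_ofReal]
    simp only [h1]
    rw [intervalIntegral.integral_finsetSum]
    · simp only [intervalIntegral.integral_const_mul, integral_fourierSymbol_mul_exp]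
      push_cast
      rw [Finset.mul_sum]
      refine Finset.sum_congr rfl fun l _ => ?_
      rw [← Complex.mul_conj']
      ring
    · intro l _
      apply Continuous.intervalIntegrable
      have := continuous_fourierSymbol b
      fun_prop
  exact_mod_cast h2

theorem hasDerivAt_fourierSymbol (b : ℤ →₀ ℂ) (θ : ℂ) :
    HasDerivAt (fourierSymbol b)
      (∑ l ∈ b.support, b l * (Complex.I * (l : ℂ)) * Complex.exp (Complex.I * (l : ℂ) * θ)) θ := by
  unfold fourierSymbol
  refine HasDerivAt.fun_sum fun l _ => ?_
  have h := (((hasDerivAt_id θ).const_mul (Complex.I * (l : ℂ))).cexp).const_mul (b l)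
  convert! h using 1
  simp
  ring

/-- The sequence `(j - x) b_j`. -/
def weightedSeq (b : ℤ →₀ ℂ) (x : ℝ) : ℤ →₀ ℂ :=
  Finsupp.ofSupportFinite (fun j => ((j : ℂ) - x) * b j)
    (b.hasFiniteSupport.subset fun j hj => by
      simp only [Function.mem_support] at hj ⊢
      exact right_ne_zero_of_mul hj)

theorem weightedSeq_apply (b : ℤ →₀ ℂ) (x : ℝ) (j : ℤ) :
    weightedSeq b x j = ((j : ℂ) - x) * b j := rfl

theorem fourierSymbol_eq_sum_of_subset (b : ℤ →₀ ℂ) {s : Finset ℤ} (hs : b.support ⊆ s) (θ : ℂ) :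
    fourierSymbol b θ = ∑ l ∈ s, b l * Complex.exp (Complex.I * (l : ℂ) * θ) :=
  Finset.sum_subset hs fun l _ hl => by simp [Finsupp.notMem_support_iff.mp hl]

theorem support_weightedSeq_subset (b : ℤ →₀ ℂ) (x : ℝ) :
    (weightedSeq b x).support ⊆ b.support := fun j hj => by
  rw [Finsupp.mem_support_iff, weightedSeq_apply] at hj
  exact Finsupp.mem_support_iff.mpr (right_ne_zero_of_mul hj)

/-- Multiplication by `j` is `-i d/dθ` on the Fourier side, so Parseval turns weighted ℓ² bounds
into bounds on the derivative of the symbol. -/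
theorem fourierSymbol_weightedSeq (b : ℤ →₀ ℂ) (x : ℝ) (θ : ℂ) :
    fourierSymbol (weightedSeq b x) θ =
      -Complex.I * deriv (fourierSymbol b) θ - x * fourierSymbol b θ := by
  rw [fourierSymbol_eq_sum_of_subset _ (support_weightedSeq_subset b x),
    (hasDerivAt_fourierSymbol b θ).deriv, fourierSymbol, Finset.mul_sum, Finset.mul_sum,
    ← Finset.sum_sub_distrib]
  refine Finset.sum_congr rfl fun l _ => ?_
  rw [weightedSeq_apply]
  linear_combination ((l : ℂ) * b l * Complex.exp (Complex.I * (l : ℂ) * θ)) * Complex.I_mul_I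

/-! ### Quartic Gaussian moments -/

theorem integrable_abs_pow_mul_exp_quartic {d : ℝ} (hd : 0 < d) (k : ℕ) :
    Integrable fun t : ℝ => |t| ^ k * Real.exp (-d * t ^ 4) := by
  -- Comparison with a Gaussian: `t⁴ ≥ t² - 1/4` gives `exp(-dt⁴) ≤ exp(d/4) exp(-dt²)`.
  have h := (integrable_rpow_mul_exp_neg_mul_sq hd (s := (k : ℝ))
    (by linarith [Nat.cast_nonneg (α := ℝ) k])).norm.const_mul (Real.exp (d / 4))
  refine h.mono' (by fun_prop) (ae_of_all _ fun t => ?_)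
  rw [Real.norm_of_nonneg (by positivity), norm_mul, Real.rpow_natCast, norm_pow,
    Real.norm_eq_abs, Real.norm_of_nonneg (Real.exp_pos _).le, mul_left_comm, ← Real.exp_add]
  gcongr
  nlinarith [sq_nonneg (t ^ 2 - 1 / 2)]

/-- The moments of the weight `exp (-d t⁴)`. -/
def quarticMoment (d : ℝ) (k : ℕ) : ℝ := ∫ t : ℝ, |t| ^ k * Real.exp (-d * t ^ 4)

theorem quarticMoment_nonneg (d : ℝ) (k : ℕ) : 0 ≤ quarticMoment d k :=
  integral_nonneg fun _ => by positivity

theorem integrable_abs_pow_mul_exp_quartic_scaled {d l : ℝ} (hd : 0 < d) (hl : 0 < l) (k : ℕ) :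
    Integrable fun t : ℝ => |t| ^ k * Real.exp (-d * (l * t) ^ 4) := by
  have h := integrable_abs_pow_mul_exp_quartic (d := d * l ^ 4) (by positivity) k
  refine h.congr (ae_of_all _ fun t => ?_)
  beta_reduce
  congr 2
  ring

theorem integral_abs_pow_mul_exp_quartic_scaled {d l : ℝ} (hl : 0 < l) (k : ℕ) :
    ∫ t : ℝ, |t| ^ k * Real.exp (-d * (l * t) ^ 4) = quarticMoment d k / l ^ (k + 1) := by
  have h := Measure.integral_comp_mul_left (fun t : ℝ => |t| ^ k * Real.exp (-d * t ^ 4)) l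
  have h2 : ∀ t : ℝ, |l * t| ^ k * Real.exp (-d * (l * t) ^ 4) =
      l ^ k * (|t| ^ k * Real.exp (-d * (l * t) ^ 4)) := by
    intro t
    rw [abs_mul, abs_of_pos hl]
    ring
  simp only [h2, integral_const_mul] at h
  rw [abs_of_pos (inv_pos.mpr hl), smul_eq_mul] at h
  rw [quarticMoment, eq_div_iff (by positivity), pow_succ, ← mul_assoc, mul_comm _ (l ^ k), h]
  field_simp

/-! ### Bounds on the Fourier symbol -/

/-- The leading part of the symbol near the origin. -/
def modelSymbol (α c₃ c₄ : ℝ) (θ : ℝ) : ℂ :=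
  Complex.exp (Complex.I * (α : ℂ) * θ - Complex.I * (c₃ : ℂ) * (θ : ℂ) ^ 3
    - (c₄ : ℂ) * (θ : ℂ) ^ 4)

theorem norm_modelSymbol (α c₃ c₄ : ℝ) (θ : ℝ) :
    ‖modelSymbol α c₃ c₄ θ‖ = Real.exp (-c₄ * θ ^ 4) := by
  rw [modelSymbol, Complex.norm_exp]
  congr 1
  have : Complex.I * (α : ℂ) * θ - Complex.I * (c₃ : ℂ) * (θ : ℂ) ^ 3 - (c₄ : ℂ) * (θ : ℂ) ^ 4 =
      ((-c₄ * θ ^ 4 : ℝ) : ℂ) + ((α * θ - c₃ * θ ^ 3 : ℝ) : ℂ) * Complex.I := by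
    push_cast
    ring
  rw [this, Complex.add_re, Complex.ofReal_re, Complex.re_ofReal_mul, Complex.I_re]
  ring

theorem DispersiveAssumption.local_bounds {a : ℤ →₀ ℂ} {α c₃ c₄ : ℝ}
    (ha : DispersiveAssumption a α c₃ c₄) :
    ∃ r C : ℝ, 0 < r ∧ r ≤ 1 ∧ 0 ≤ C ∧ ∀ θ : ℝ, |θ| < r →
      ‖fourierSymbol a θ‖ ≤ Real.exp (-(c₄ / 2) * θ ^ 4) ∧
      ‖fourierSymbol a θ - modelSymbol α c₃ c₄ θ‖ ≤ C * |θ| ^ 5 ∧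
      ‖fourierSymbol (weightedSeq a α) θ‖ ≤ C * θ ^ 2 := by
  obtain ⟨φ, U, hU, h0, hφ, hexp⟩ := ha.expansion
  obtain ⟨r₁, hr₁, hball⟩ := Metric.nhds_basis_closedBall.mem_iff.mp (hU.mem_nhds h0)
  have hcpt : IsCompact (Metric.closedBall (0 : ℂ) r₁) := isCompact_closedBall _ _
  obtain ⟨B₁, hB₁⟩ := hcpt.exists_bound_of_continuousOn (hφ.continuousOn.mono hball)
  obtain ⟨B₂, hB₂⟩ := hcpt.exists_bound_of_continuousOn ((hφ.deriv hU).continuousOn.mono hball)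
  set B := max (max B₁ B₂) 1 with hB
  have hB1 : 1 ≤ B := le_max_right _ _
  have hc₄ := ha.c₄_pos
  -- The entry `1 / B` keeps `|θ⁵φ(θ)| ≤ 1`, as `|e^w - 1| ≤ 2|w|` requires; the entry `c₄ / (2B)`
  -- makes the remainder cost at most half of `c₄θ⁴`.
  set r := min r₁ (min 1 (min (1 / B) (c₄ / (2 * B)))) with hr
  have hBpos : 0 < B := by linarith
  have hrpos : 0 < r := by positivity
  have hrr₁ : r ≤ r₁ := min_le_left _ _
  have hr1 : r ≤ 1 := (min_le_right _ _).trans (min_le_left _ _)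
  have hrB : r ≤ 1 / B := ((min_le_right _ _).trans (min_le_right _ _)).trans (min_le_left _ _)
  have hrc : r ≤ c₄ / (2 * B) :=
    ((min_le_right _ _).trans (min_le_right _ _)).trans (min_le_right _ _)
  rw [le_div_iff₀ hBpos] at hrB
  rw [le_div_iff₀ (by positivity)] at hrc
  refine ⟨r, max (2 * B) (3 * |c₃| + 4 * c₄ + 6 * B), hrpos, hr1, by positivity, ?_⟩
  intro θ hθ
  have hθ1 : |θ| ≤ 1 := by linarith
  have hmem : (θ : ℂ) ∈ Metric.closedBall (0 : ℂ) r₁ := by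
    rw [mem_closedBall_zero_iff, Complex.norm_real, Real.norm_eq_abs]
    linarith
  have hU' := hball hmem
  have hφB : ‖φ θ‖ ≤ B := (hB₁ _ hmem).trans ((le_max_left _ _).trans (le_max_left _ _))
  have hφ'B : ‖deriv φ θ‖ ≤ B := (hB₂ _ hmem).trans ((le_max_right _ _).trans (le_max_left _ _))
  have hnθ : ‖(θ : ℂ)‖ = |θ| := by rw [Complex.norm_real, Real.norm_eq_abs]
  have hz : ‖(θ : ℂ) ^ 5 * φ θ‖ ≤ B * |θ| ^ 5 := by
    rw [norm_mul, norm_pow, hnθ, mul_comm]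
    gcongr
  have hfac : fourierSymbol a θ =
      modelSymbol α c₃ c₄ θ * Complex.exp ((θ : ℂ) ^ 5 * φ θ) := by
    rw [hexp _ hU', modelSymbol, ← Complex.exp_add]
  have h4 : |θ| ^ 4 = θ ^ 4 := by rw [← abs_pow]; exact abs_of_nonneg (by positivity)
  have hnorm : ‖fourierSymbol a θ‖ ≤ Real.exp (-(c₄ / 2) * θ ^ 4) := by
    rw [hfac, norm_mul, norm_modelSymbol, Complex.norm_exp, ← Real.exp_add]
    gcongr
    have h1 : ((θ : ℂ) ^ 5 * φ θ).re ≤ B * |θ| ^ 5 := (Complex.re_le_norm _).trans hz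
    have h2 : B * |θ| ^ 5 ≤ c₄ / 2 * θ ^ 4 := by
      rw [← h4, show B * |θ| ^ 5 = (|θ| * B) * |θ| ^ 4 by ring]
      gcongr
      nlinarith
    nlinarith
  refine ⟨hnorm, ?_, ?_⟩
  · have h1 : ‖Complex.exp ((θ : ℂ) ^ 5 * φ θ) - 1‖ ≤ 2 * ‖(θ : ℂ) ^ 5 * φ θ‖ := by
      refine Complex.norm_exp_sub_one_le (hz.trans ?_)
      have : |θ| ^ 5 ≤ |θ| := pow_le_of_le_one (abs_nonneg _) hθ1 (by norm_num)
      nlinarith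
    calc ‖fourierSymbol a θ - modelSymbol α c₃ c₄ θ‖
        = ‖modelSymbol α c₃ c₄ θ‖ * ‖Complex.exp ((θ : ℂ) ^ 5 * φ θ) - 1‖ := by
          rw [← norm_mul, hfac]
          congr 1
          ring
      _ ≤ 1 * (2 * (B * |θ| ^ 5)) := by
          refine mul_le_mul ?_ (by linarith) (norm_nonneg _) zero_le_one
          rw [norm_modelSymbol]
          exact Real.exp_le_one_iff.mpr (by nlinarith [show 0 ≤ θ ^ 4 by positivity])
      _ = 2 * B * |θ| ^ 5 := by ring
      _ ≤ _ := by gcongr; exact le_max_left _ _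
  · have hev : fourierSymbol a =ᶠ[𝓝 (θ : ℂ)] fun z =>
        Complex.exp (Complex.I * (α : ℂ) * z - Complex.I * (c₃ : ℂ) * z ^ 3 - (c₄ : ℂ) * z ^ 4
          + z ^ 5 * φ z) := by
      filter_upwards [hU.mem_nhds hU'] with z hz using hexp z hz
    have hφd : HasDerivAt φ (deriv φ θ) (θ : ℂ) :=
      (hφ.differentiableAt (hU.mem_nhds hU')).hasDerivAt
    have hid := hasDerivAt_id (θ : ℂ)
    have hd := (((hid.const_mul (Complex.I * (α : ℂ))).sub
      ((hid.pow 3).const_mul (Complex.I * (c₃ : ℂ)))).sub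
      ((hid.pow 4).const_mul (c₄ : ℂ))).add ((hid.pow 5).mul hφd)
    have hd' := hd.cexp.congr_of_eventuallyEq (f₁ := fourierSymbol a) hev
    -- With `F = e^w`, the left side is `F · (-iw' - α)`. Centring at `α` removes the constant term,
    -- and `w` has no quadratic term, so `θ²` factors out.
    have hkey : fourierSymbol (weightedSeq a α) θ = fourierSymbol a θ * ((θ : ℂ) ^ 2 *
        (-3 * c₃ + 4 * Complex.I * c₄ * θ - 5 * Complex.I * (θ : ℂ) ^ 2 * φ θ
          - Complex.I * (θ : ℂ) ^ 3 * deriv φ θ)) := by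
      rw [fourierSymbol_weightedSeq, hd'.deriv, hexp _ hU']
      simp only [Pi.add_apply, Pi.sub_apply, Pi.mul_apply, Pi.pow_apply, id]
      push_cast
      linear_combination (-(α : ℂ) + 3 * c₃ * θ ^ 2) *
        Complex.exp (Complex.I * (α : ℂ) * θ - Complex.I * (c₃ : ℂ) * (θ : ℂ) ^ 3
          - (c₄ : ℂ) * (θ : ℂ) ^ 4 + (θ : ℂ) ^ 5 * φ θ) * Complex.I_mul_I
    have hb1 : ‖fourierSymbol a θ‖ ≤ 1 :=
      hnorm.trans (Real.exp_le_one_iff.mpr (by nlinarith [show 0 ≤ θ ^ 4 by positivity]))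
    rw [hkey, norm_mul, norm_mul, norm_pow, hnθ, sq_abs]
    have hpow : ∀ k : ℕ, |θ| ^ k ≤ 1 := fun k => pow_le_one₀ (abs_nonneg _) hθ1
    have hsum : ‖(-3 * c₃ + 4 * Complex.I * c₄ * θ - 5 * Complex.I * (θ : ℂ) ^ 2 * φ θ
          - Complex.I * (θ : ℂ) ^ 3 * deriv φ θ : ℂ)‖ ≤ 3 * |c₃| + 4 * c₄ + 6 * B := by
      refine (norm_sub_le _ _).trans ?_
      have e1 : ‖(-3 * c₃ + 4 * Complex.I * c₄ * θ - 5 * Complex.I * (θ : ℂ) ^ 2 * φ θ : ℂ)‖ ≤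
          3 * |c₃| + 4 * c₄ + 5 * B := by
        refine (norm_sub_le _ _).trans (add_le_add ((norm_add_le _ _).trans (add_le_add ?_ ?_)) ?_)
        · simp
        · simp only [norm_mul, Complex.norm_I, Complex.norm_real, Real.norm_eq_abs,
            abs_of_pos hc₄]
          norm_num
          nlinarith
        · simp only [norm_mul, norm_pow, Complex.norm_I, hnθ]
          norm_num
          have := hpow 2
          rw [sq_abs] at this
          nlinarith [norm_nonneg (φ θ)]
      have e2 : ‖Complex.I * (θ : ℂ) ^ 3 * deriv φ θ‖ ≤ B := by
        simp only [norm_mul, norm_pow, Complex.norm_I, hnθ]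
        nlinarith [norm_nonneg (deriv φ θ), hpow 3, pow_nonneg (abs_nonneg θ) 3]
      linarith
    calc _ ≤ 1 * (θ ^ 2 * (3 * |c₃| + 4 * c₄ + 6 * B)) := by gcongr
      _ = (3 * |c₃| + 4 * c₄ + 6 * B) * θ ^ 2 := by ring
      _ ≤ _ := by gcongr; exact le_max_right _ _

theorem DispersiveAssumption.symbol_bounds {a : ℤ →₀ ℂ} {α c₃ c₄ : ℝ}
    (ha : DispersiveAssumption a α c₃ c₄) :
    ∃ c C : ℝ, 0 < c ∧ c ≤ c₄ ∧ 0 ≤ C ∧ ∀ θ : ℝ, |θ| ≤ Real.pi →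
      ‖fourierSymbol a θ‖ ≤ Real.exp (-c * θ ^ 4) ∧
      ‖fourierSymbol a θ - modelSymbol α c₃ c₄ θ‖ ≤ C * |θ| ^ 5 ∧
      ‖fourierSymbol (weightedSeq a α) θ‖ ≤ C * θ ^ 2 := by
  obtain ⟨r, C₁, hr, hr1, hC₁, hloc⟩ := ha.local_bounds
  have hc₄ := ha.c₄_pos
  have hpi := Real.pi_pos
  set K : Set ℝ := Icc (-Real.pi) Real.pi ∩ {θ | r ≤ |θ|} with hK
  have hKc : IsCompact K := isCompact_Icc.inter_right (isClosed_le continuous_const continuous_abs)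
  have hKne : K.Nonempty := ⟨Real.pi, ⟨by linarith, le_rfl⟩, by
    change r ≤ |Real.pi|
    rw [abs_of_pos hpi]
    linarith [Real.pi_gt_three]⟩
  have hcont : Continuous fun θ : ℝ => fourierSymbol a (θ : ℂ) :=
    (continuous_fourierSymbol a).comp Complex.continuous_ofReal
  have hcontw : Continuous fun θ : ℝ => fourierSymbol (weightedSeq a α) (θ : ℂ) :=
    (continuous_fourierSymbol _).comp Complex.continuous_ofReal
  obtain ⟨θ₀, hθ₀, hmax⟩ := hKc.exists_isMaxOn hKne hcont.norm.continuousOn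
  obtain ⟨D, hD⟩ := hKc.exists_bound_of_continuousOn hcontw.continuousOn
  set q := ‖fourierSymbol a (θ₀ : ℂ)‖ with hq
  have hq1 : q < 1 := ha.dissipation θ₀ hθ₀.1 (by
    rintro rfl
    have := hθ₀.2
    simp only [mem_ofPred_eq, abs_zero] at this
    linarith)
  -- Away from 0 the modulus is at most `q < 1`. For `|θ| ≤ π` the second entry gives `q ≤ 1 - cθ⁴ ≤
  -- exp(-cθ⁴)`.
  set c := min (c₄ / 2) ((1 - q) / Real.pi ^ 4) with hc
  have hcpos : 0 < c := lt_min (by linarith) (div_pos (by linarith) (by positivity))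
  -- For `|θ| ≥ r` the trivial bounds `2` and `D` are multiplied by `|θ|⁵ / r⁵` and `θ² / r²`, both
  -- at least 1.
  refine ⟨c, max C₁ (max (2 / r ^ 5) (D / r ^ 2)), hcpos,
    (min_le_left _ _).trans (by linarith), le_max_of_le_left hC₁, ?_⟩
  intro θ hθ
  have h40 : 0 ≤ θ ^ 4 := by positivity
  rcases lt_or_ge |θ| r with h | h
  · obtain ⟨h1, h2, h3⟩ := hloc θ h
    refine ⟨h1.trans ?_, h2.trans ?_, h3.trans ?_⟩
    · gcongr
      exact min_le_left _ _
    · gcongr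
      exact le_max_left _ _
    · gcongr
      exact le_max_left _ _
  · have hmem : θ ∈ K := ⟨abs_le.mp hθ, h⟩
    have hPq : ‖fourierSymbol a θ‖ ≤ q := hmax hmem
    refine ⟨hPq.trans ?_, ?_, (hD θ hmem).trans ?_⟩
    · have h5 : c * θ ^ 4 ≤ 1 - q := by
        have h6 : θ ^ 4 ≤ Real.pi ^ 4 := by
          rw [← abs_of_nonneg h40, abs_pow]
          gcongr
        calc c * θ ^ 4 ≤ (1 - q) / Real.pi ^ 4 * Real.pi ^ 4 := by
              gcongr
              exact min_le_right _ _
          _ = 1 - q := by field_simp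
      have h7 := Real.add_one_le_exp (-c * θ ^ 4)
      linarith
    · have h8 : ‖modelSymbol α c₃ c₄ θ‖ ≤ 1 := by
        rw [norm_modelSymbol]
        exact Real.exp_le_one_iff.mpr (by nlinarith)
      have h9 : (1 : ℝ) ≤ |θ| ^ 5 / r ^ 5 := by
        rw [one_le_div (by positivity)]
        gcongr
      calc ‖fourierSymbol a θ - modelSymbol α c₃ c₄ θ‖ ≤ 2 := by
            linarith [norm_sub_le (fourierSymbol a θ) (modelSymbol α c₃ c₄ θ)]
        _ ≤ 2 * (|θ| ^ 5 / r ^ 5) := by linarith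
        _ = 2 / r ^ 5 * |θ| ^ 5 := by ring
        _ ≤ _ := by
          gcongr
          exact (le_max_left _ _).trans (le_max_right _ _)
    · have hD0 : 0 ≤ D := (norm_nonneg _).trans (hD θ hmem)
      have h9 : (1 : ℝ) ≤ θ ^ 2 / r ^ 2 := by
        rw [one_le_div (by positivity), ← sq_abs θ]
        gcongr
      calc D ≤ D * (θ ^ 2 / r ^ 2) := le_mul_of_one_le_right hD0 h9
        _ = D / r ^ 2 * θ ^ 2 := by ring
        _ ≤ _ := by
          gcongr
          exact (le_max_right _ _).trans (le_max_right _ _)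

/-! ### Consequences for the Green's function -/

theorem norm_pow_sub_pow_le_of_norm_le {x y : ℂ} {M : ℝ} (hx : ‖x‖ ≤ M) (hy : ‖y‖ ≤ M) (n : ℕ) :
    ‖x ^ (n + 1) - y ^ (n + 1)‖ ≤ (n + 1) * ‖x - y‖ * M ^ n := by
  have hM : 0 ≤ M := (norm_nonneg x).trans hx
  induction n with
  | zero => simp
  | succ n ih =>
    have h : x ^ (n + 1 + 1) - y ^ (n + 1 + 1) =
        (x ^ (n + 1) - y ^ (n + 1)) * x + y ^ (n + 1) * (x - y) := by ring
    rw [h]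
    calc _ ≤ ‖x ^ (n + 1) - y ^ (n + 1)‖ * ‖x‖ + ‖y‖ ^ (n + 1) * ‖x - y‖ := by
          refine (norm_add_le _ _).trans ?_
          rw [norm_mul, norm_mul, norm_pow]
      _ ≤ ((n + 1) * ‖x - y‖ * M ^ n) * M + M ^ (n + 1) * ‖x - y‖ := by gcongr
      _ = _ := by push_cast; ring

/-- The rescaled oscillatory integral approximating the Green's function. -/
def oscInt (c₃ c₄ l z : ℝ) : ℂ :=
  ∫ t : ℝ, Complex.exp (-(Complex.I * l * (c₃ * (t : ℂ) ^ 3 - z * t)) - c₄ * (t : ℂ) ^ 4)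

section Bounds

variable {a : ℤ →₀ ℂ} {α c₃ c₄ c C : ℝ}

/-- Differentiating or telescoping an `(n+1)`-th power leaves an n-th power. Since `n ≥ (n+1)/2` for
`n ≥ 1`, the lost factor costs only half of the decay constant. -/
theorem exp_quartic_pow_le {c θ l : ℝ} {n : ℕ} (hc : 0 < c) (hn : 1 ≤ n)
    (hl : l ^ 4 = (n + 1 : ℕ)) :
    Real.exp (-c * θ ^ 4) ^ n ≤ Real.exp (-(c / 2) * (l * θ) ^ 4) := by
  rw [← Real.exp_nat_mul, mul_pow, hl, Real.exp_le_exp]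
  have h1 : (1 : ℝ) ≤ n := by exact_mod_cast hn
  push_cast
  have h2 : 0 ≤ c * θ ^ 4 := by positivity
  nlinarith

theorem sum_norm_sq_convPow_le (hc : 0 < c)
    (hP : ∀ θ : ℝ, |θ| ≤ Real.pi → ‖fourierSymbol a θ‖ ≤ Real.exp (-c * θ ^ 4))
    {n : ℕ} {l : ℝ} (hl0 : 0 < l) (hl : l ^ 4 = n) :
    ∑ j ∈ (convPow a n).support, ‖convPow a n j‖ ^ 2 ≤
      (2 * Real.pi)⁻¹ * quarticMoment c 0 / l := by
  have hpi := Real.pi_pos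
  have h1 := integral_norm_fourierSymbol_sq (convPow a n)
  have hle : -Real.pi ≤ Real.pi := by linarith
  have hint := integrable_abs_pow_mul_exp_quartic_scaled hc hl0 0
  have h2 : ∫ θ in (-Real.pi)..Real.pi, ‖fourierSymbol (convPow a n) (θ : ℂ)‖ ^ 2 ≤
      ∫ θ : ℝ, |θ| ^ 0 * Real.exp (-c * (l * θ) ^ 4) := by
    rw [intervalIntegral.integral_of_le hle]
    refine (setIntegral_mono_on (g := fun θ : ℝ => |θ| ^ 0 * Real.exp (-c * (l * θ) ^ 4)) ?_
      hint.integrableOn measurableSet_Ioc fun θ hθ => ?_).trans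
      (setIntegral_le_integral hint (ae_of_all _ fun θ => by positivity))
    · refine Continuous.integrableOn_Ioc ?_
      have := continuous_fourierSymbol (convPow a n)
      fun_prop
    · have h3 := hP θ (abs_le.mpr ⟨hθ.1.le, hθ.2⟩)
      rw [fourierSymbol_convPow, norm_pow, pow_zero, one_mul]
      calc (‖fourierSymbol a θ‖ ^ n) ^ 2 ≤ (Real.exp (-c * θ ^ 4) ^ n) ^ 2 := by gcongr
        _ = Real.exp (2 * (-c * (l * θ) ^ 4)) := by
          rw [← Real.exp_nat_mul, ← Real.exp_nat_mul, mul_pow l, hl]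
          push_cast
          ring_nf
        _ ≤ _ := by
          rw [Real.exp_le_exp]
          nlinarith [show 0 ≤ c * (l * θ) ^ 4 by positivity]
  rw [integral_abs_pow_mul_exp_quartic_scaled hl0, h1, zero_add, pow_one] at h2
  rw [mul_div_assoc, ← div_le_iff₀' (by positivity), div_inv_eq_mul, mul_comm]
  exact h2

theorem fourierSymbol_weightedSeq_convPow (a : ℤ →₀ ℂ) (α : ℝ) (n : ℕ) (θ : ℂ) :
    fourierSymbol (weightedSeq (convPow a (n + 1)) (α * (n + 1 : ℕ))) θ =
      (n + 1 : ℕ) * fourierSymbol a θ ^ n * fourierSymbol (weightedSeq a α) θ := by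
  have h : fourierSymbol (convPow a (n + 1)) = fun z => fourierSymbol a z ^ (n + 1) :=
    funext fun z => fourierSymbol_convPow a (n + 1) z
  have hd := (hasDerivAt_fourierSymbol a θ).differentiableAt.hasDerivAt.fun_pow (n + 1)
  rw [fourierSymbol_weightedSeq, fourierSymbol_weightedSeq, h, hd.deriv]
  push_cast
  ring

/-- The derivative of the n-th power brings down `n = l⁴` and a factor `O(θ²)`. The squared
integrand is thus `O(l⁸θ⁴)` times a weight of width `1/l`, and `∫ θ⁴` over that scale is of order
`l⁻⁵`. -/
theorem sum_weighted_norm_sq_convPow_le (hc : 0 < c)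
    (hP : ∀ θ : ℝ, |θ| ≤ Real.pi → ‖fourierSymbol a θ‖ ≤ Real.exp (-c * θ ^ 4))
    (hW : ∀ θ : ℝ, |θ| ≤ Real.pi → ‖fourierSymbol (weightedSeq a α) θ‖ ≤ C * θ ^ 2)
    {n : ℕ} {l : ℝ} (hn : 2 ≤ n) (hl0 : 0 < l) (hl : l ^ 4 = n) :
    ∑ j ∈ (convPow a n).support, ((j : ℝ) - α * n) ^ 2 * ‖convPow a n j‖ ^ 2 ≤
      (2 * Real.pi)⁻¹ * (C ^ 2 * quarticMoment (c / 2) 4) * l ^ 3 := by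
  obtain ⟨m, rfl⟩ : ∃ m, n = m + 1 := ⟨n - 1, by omega⟩
  have hpi := Real.pi_pos
  have h1 := integral_norm_fourierSymbol_sq (weightedSeq (convPow a (m + 1)) (α * (m + 1 : ℕ)))
  have hsum : ∑ j ∈ (weightedSeq (convPow a (m + 1)) (α * (m + 1 : ℕ))).support,
      ‖weightedSeq (convPow a (m + 1)) (α * (m + 1 : ℕ)) j‖ ^ 2 =
      ∑ j ∈ (convPow a (m + 1)).support,
        ((j : ℝ) - α * (m + 1 : ℕ)) ^ 2 * ‖convPow a (m + 1) j‖ ^ 2 := by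
    rw [Finset.sum_subset (support_weightedSeq_subset _ _)
      (fun j _ hj => by rw [Finsupp.notMem_support_iff.mp hj]; simp)]
    refine Finset.sum_congr rfl fun j _ => ?_
    rw [weightedSeq_apply, norm_mul, mul_pow]
    congr 1
    rw [show ((j : ℂ) - ((α * (m + 1 : ℕ) : ℝ) : ℂ)) = (((j : ℝ) - α * (m + 1 : ℕ) : ℝ) : ℂ) by
      push_cast; ring, Complex.norm_real, Real.norm_eq_abs, sq_abs]
  have hle : -Real.pi ≤ Real.pi := by linarith
  have hint := (integrable_abs_pow_mul_exp_quartic_scaled (half_pos hc) hl0 4).const_mul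
    (l ^ 8 * C ^ 2)
  have h2 : ∫ θ in (-Real.pi)..Real.pi,
      ‖fourierSymbol (weightedSeq (convPow a (m + 1)) (α * (m + 1 : ℕ))) (θ : ℂ)‖ ^ 2 ≤
      ∫ θ : ℝ, l ^ 8 * C ^ 2 * (|θ| ^ 4 * Real.exp (-(c / 2) * (l * θ) ^ 4)) := by
    rw [intervalIntegral.integral_of_le hle]
    refine (setIntegral_mono_on ?_
      hint.integrableOn measurableSet_Ioc fun θ hθ => ?_).trans
      (setIntegral_le_integral hint (ae_of_all _ fun θ => by positivity))
    · refine Continuous.integrableOn_Ioc ?_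
      have := continuous_fourierSymbol (weightedSeq (convPow a (m + 1)) (α * (m + 1 : ℕ)))
      fun_prop
    · have hθ' := abs_le.mpr ⟨hθ.1.le, hθ.2⟩
      have h3 := hP θ hθ'
      have h4 := hW θ hθ'
      rw [fourierSymbol_weightedSeq_convPow, norm_mul, norm_mul, norm_pow, Complex.norm_natCast,
        ← hl]
      have h5 : ‖fourierSymbol a θ‖ ^ m ≤ Real.exp (-(c / 2) * (l * θ) ^ 4) :=
        (pow_le_pow_left₀ (norm_nonneg _) h3 m).trans (exp_quartic_pow_le hc (by omega) hl)
      have h6 : Real.exp (-(c / 2) * (l * θ) ^ 4) ≤ 1 :=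
        Real.exp_le_one_iff.mpr (by nlinarith [show 0 ≤ c * (l * θ) ^ 4 by positivity])
      have h7 := Real.exp_pos (-(c / 2) * (l * θ) ^ 4)
      calc (l ^ 4 * ‖fourierSymbol a θ‖ ^ m * ‖fourierSymbol (weightedSeq a α) θ‖) ^ 2
          ≤ (l ^ 4 * Real.exp (-(c / 2) * (l * θ) ^ 4) * (C * θ ^ 2)) ^ 2 := by gcongr
        _ = l ^ 8 * C ^ 2 * (|θ| ^ 4 *
            (Real.exp (-(c / 2) * (l * θ) ^ 4) * Real.exp (-(c / 2) * (l * θ) ^ 4))) := by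
          rw [show |θ| ^ 4 = (|θ| ^ 2) ^ 2 by ring, sq_abs]
          ring
        _ ≤ l ^ 8 * C ^ 2 * (|θ| ^ 4 * (1 * Real.exp (-(c / 2) * (l * θ) ^ 4))) := by gcongr
        _ = _ := by rw [one_mul]
  rw [integral_const_mul, integral_abs_pow_mul_exp_quartic_scaled hl0, h1, hsum] at h2
  rw [mul_assoc, ← div_le_iff₀' (by positivity), div_inv_eq_mul, mul_comm]
  refine h2.trans (le_of_eq ?_)
  field_simp
  ring

/-- Under `t = lθ` with `l⁴ = n`, the cubic and linear terms both acquire exactly one factor `l`,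
while the quartic term loses its dependence on `l`. -/
theorem modelSymbol_pow_mul_exp {n : ℕ} {l : ℝ} (hl0 : 0 < l) (hl : l ^ 4 = n) (j : ℤ) (θ : ℝ) :
    modelSymbol α c₃ c₄ θ ^ n * Complex.exp (-(Complex.I * (j : ℂ) * (θ : ℂ))) =
      Complex.exp (-(Complex.I * l * (c₃ * ((l * θ : ℝ) : ℂ) ^ 3 -
        ((α * n - j) / l ^ 2 : ℝ) * ((l * θ : ℝ) : ℂ))) - c₄ * ((l * θ : ℝ) : ℂ) ^ 4) := by
  have hlC : (l : ℂ) ^ 4 = n := by exact_mod_cast hl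
  have hl0C : (l : ℂ) ≠ 0 := by exact_mod_cast hl0.ne'
  rw [modelSymbol, ← Complex.exp_nat_mul, ← Complex.exp_add, ← hlC, ← hl]
  congr 1
  push_cast
  field_simp
  ring

theorem integral_modelSymbol_pow_mul_exp {n : ℕ} {l : ℝ} (hl0 : 0 < l) (hl : l ^ 4 = n) (j : ℤ) :
    ∫ θ : ℝ, modelSymbol α c₃ c₄ θ ^ n * Complex.exp (-(Complex.I * (j : ℂ) * (θ : ℂ))) =
      l⁻¹ * oscInt c₃ c₄ l ((α * n - j) / l ^ 2) := by
  simp only [modelSymbol_pow_mul_exp hl0 hl]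
  rw [Measure.integral_comp_mul_left (fun t : ℝ => Complex.exp (-(Complex.I * l *
    (c₃ * (t : ℂ) ^ 3 - ((α * n - j) / l ^ 2 : ℝ) * (t : ℂ))) - c₄ * (t : ℂ) ^ 4)) l, oscInt,
    abs_of_pos (inv_pos.mpr hl0), Complex.real_smul, Complex.ofReal_inv]

/-- Telescoping the difference of n-th powers gives the majorant `n |θ|⁵ exp(-(c/2)(lθ)⁴)`, whose
integral has order `l⁴ · l⁻⁶`. -/
theorem norm_convPow_sub_oscInt_le (hc : 0 < c) (hc₄ : c ≤ c₄) (hC : 0 ≤ C)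
    (hP : ∀ θ : ℝ, |θ| ≤ Real.pi → ‖fourierSymbol a θ‖ ≤ Real.exp (-c * θ ^ 4))
    (hH : ∀ θ : ℝ, |θ| ≤ Real.pi →
      ‖fourierSymbol a θ - modelSymbol α c₃ c₄ θ‖ ≤ C * |θ| ^ 5)
    {n : ℕ} {l : ℝ} (hn : 2 ≤ n) (hl0 : 0 < l) (hl : l ^ 4 = n) (j : ℤ) :
    ‖convPow a n j - (2 * Real.pi * l : ℂ)⁻¹ * oscInt c₃ c₄ l ((α * n - j) / l ^ 2)‖ ≤
      (2 * Real.pi)⁻¹ * ((C + 1) * quarticMoment (c / 2) 5) / l ^ 2 := by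
  have hpi := Real.pi_pos
  have hpi3 := Real.pi_gt_three
  have hle : -Real.pi ≤ Real.pi := by linarith
  set E : ℝ → ℂ := fun θ => Complex.exp (-(Complex.I * (j : ℂ) * (θ : ℂ))) with hE
  have hEn : ∀ θ, ‖E θ‖ = 1 := by
    intro θ
    have : -(Complex.I * (j : ℂ) * (θ : ℂ)) = ((-(j * θ) : ℝ) : ℂ) * Complex.I := by
      push_cast; ring
    simp only [hE, this, Complex.norm_exp_ofReal_mul_I]
  set S : ℝ → ℂ := (Ioc (-Real.pi) Real.pi).indicator
    fun θ => fourierSymbol a (θ : ℂ) ^ n * E θ with hS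
  set T : ℝ → ℂ := fun θ => modelSymbol α c₃ c₄ θ ^ n * E θ with hT
  have hcontE : Continuous E := by fun_prop
  have hcontM : Continuous (modelSymbol α c₃ c₄) := by unfold modelSymbol; fun_prop
  have hcontP := (continuous_fourierSymbol a).comp Complex.continuous_ofReal
  have hSint : Integrable S := by
    rw [hS, integrable_indicator_iff measurableSet_Ioc]
    exact Continuous.integrableOn_Ioc ((hcontP.pow n).mul hcontE)
  have hTn : ∀ θ, ‖T θ‖ = Real.exp (-c₄ * θ ^ 4) ^ n := by
    intro θ
    rw [norm_mul, hEn, mul_one, norm_pow, norm_modelSymbol]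
  have hTint : Integrable T := by
    refine (integrable_abs_pow_mul_exp_quartic_scaled (hc.trans_le hc₄) hl0 0).mono'
      (by fun_prop) (ae_of_all _ fun θ => ?_)
    rw [hTn, ← Real.exp_nat_mul, mul_pow, hl, pow_zero, one_mul]
    apply le_of_eq
    ring_nf
  have hSval : ∫ θ, S θ = 2 * Real.pi * convPow a n j := by
    rw [hS, integral_indicator measurableSet_Ioc, ← intervalIntegral.integral_of_le hle,
      ← integral_fourierSymbol_mul_exp]
    simp only [fourierSymbol_convPow, hE]
  have hTval := integral_modelSymbol_pow_mul_exp (α := α) (c₃ := c₃) (c₄ := c₄) hl0 hl j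
  -- `C + 1` instead of `C` lets the same majorant also cover `θ` outside `(-π, π]`, where only the
  -- model is present: there `|θ| ≥ 1`, so the prefactor must be at least 1 even if `C = 0`.
  have hint := (integrable_abs_pow_mul_exp_quartic_scaled (half_pos hc) hl0 5).const_mul
    (l ^ 4 * (C + 1))
  obtain ⟨m, rfl⟩ : ∃ m, n = m + 1 := ⟨n - 1, by omega⟩
  have hbound : ‖∫ θ, (S θ - T θ)‖ ≤
      ∫ θ : ℝ, l ^ 4 * (C + 1) * (|θ| ^ 5 * Real.exp (-(c / 2) * (l * θ) ^ 4)) := by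
    refine norm_integral_le_of_norm_le hint (ae_of_all _ fun θ => ?_)
    have h5 := exp_quartic_pow_le (θ := θ) hc (by omega) hl
    have hθ4 : 0 ≤ θ ^ 4 := by positivity
    have hmono : Real.exp (-c₄ * θ ^ 4) ≤ Real.exp (-c * θ ^ 4) := by
      gcongr
    by_cases hθ : θ ∈ Ioc (-Real.pi) Real.pi
    · have hθ' := abs_le.mpr ⟨hθ.1.le, hθ.2⟩
      rw [hS, indicator_of_mem hθ, hT, ← sub_mul, norm_mul, hEn, mul_one]
      refine (norm_pow_sub_pow_le_of_norm_le (hP θ hθ')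
        ((norm_modelSymbol _ _ _ _).trans_le hmono) m).trans ?_
      rw [hl]
      push_cast
      calc _ ≤ ((m : ℝ) + 1) * (C * |θ| ^ 5) * Real.exp (-(c / 2) * (l * θ) ^ 4) := by
            gcongr
            exact hH θ hθ'
        _ ≤ ((m : ℝ) + 1) * ((C + 1) * |θ| ^ 5) * Real.exp (-(c / 2) * (l * θ) ^ 4) := by
            gcongr
            linarith
        _ = _ := by ring
    · have hθ1 : 1 ≤ |θ| := by
        by_contra! h
        exact hθ ⟨by linarith [(abs_lt.mp h).1], by linarith [(abs_lt.mp h).2]⟩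
      rw [hS, indicator_of_notMem hθ, zero_sub, norm_neg, hTn, hl]
      have h6 : (1 : ℝ) ≤ ((m + 1 : ℕ) : ℝ) * (C + 1) * |θ| ^ 5 := by
        have h7 : (1 : ℝ) ≤ |θ| ^ 5 := one_le_pow₀ hθ1
        have h8 : (1 : ℝ) ≤ ((m + 1 : ℕ) : ℝ) := by exact_mod_cast Nat.le_add_left 1 m
        have h9 : (1 : ℝ) ≤ C + 1 := by linarith
        exact one_le_mul_of_one_le_of_one_le (one_le_mul_of_one_le_of_one_le h8 h9) h7
      calc Real.exp (-c₄ * θ ^ 4) ^ (m + 1) ≤ Real.exp (-c * θ ^ 4) ^ (m + 1) := by gcongr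
        _ ≤ Real.exp (-c * θ ^ 4) ^ m :=
          pow_le_pow_of_le_one (Real.exp_pos _).le
            (Real.exp_le_one_iff.mpr (by nlinarith)) (by omega)
        _ ≤ Real.exp (-(c / 2) * (l * θ) ^ 4) := h5
        _ ≤ (((m + 1 : ℕ) : ℝ) * (C + 1) * |θ| ^ 5) * Real.exp (-(c / 2) * (l * θ) ^ 4) :=
          le_mul_of_one_le_left (Real.exp_pos _).le h6
        _ = _ := by ring
  rw [integral_sub hSint hTint, hSval, hTval, integral_const_mul,
    integral_abs_pow_mul_exp_quartic_scaled hl0] at hbound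
  have hl0C : (l : ℂ) ≠ 0 := by exact_mod_cast hl0.ne'
  have hpiC : (Real.pi : ℂ) ≠ 0 := by exact_mod_cast hpi.ne'
  have hfac : convPow a (m + 1) j - (2 * Real.pi * l : ℂ)⁻¹ *
      oscInt c₃ c₄ l ((α * (m + 1 : ℕ) - j) / l ^ 2) =
      ((2 * Real.pi : ℝ) : ℂ)⁻¹ * (2 * Real.pi * convPow a (m + 1) j -
        (l : ℂ)⁻¹ * oscInt c₃ c₄ l ((α * (m + 1 : ℕ) - j) / l ^ 2)) := by
    push_cast
    field_simp
  rw [hfac, norm_mul, norm_inv, Complex.norm_real, Real.norm_of_nonneg (by positivity),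
    mul_div_assoc]
  gcongr
  rw [Complex.ofReal_inv] at hbound
  refine hbound.trans (le_of_eq ?_)
  field_simp
  ring

end Bounds

/-! ### Oscillatory integrals -/

/-- Integration by parts against a bounded oscillating primitive. The function `h` dominates the
variation of `g`, so `g` itself need not be monotone. -/
theorem norm_integral_deriv_mul_le {G G' : ℝ → ℂ} {g g' h h' : ℝ → ℝ} {a b : ℝ} (hab : a ≤ b)
    (hG : ∀ t ∈ Icc a b, HasDerivAt G (G' t) t) (hg : ∀ t ∈ Icc a b, HasDerivAt g (g' t) t)
    (hh : ∀ t ∈ Icc a b, HasDerivAt h (h' t) t)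
    (hG'c : ContinuousOn G' (Icc a b)) (hg'c : ContinuousOn g' (Icc a b))
    (hh'c : ContinuousOn h' (Icc a b))
    (hG1 : ∀ t ∈ Icc a b, ‖G t‖ ≤ 1) (hgh : ∀ t ∈ Icc a b, |g' t| ≤ h' t) :
    ‖∫ t in a..b, (g t : ℂ) * G' t‖ ≤ |g a| + |g b| + (h b - h a) := by
  rw [← uIcc_of_le hab] at hG hg hh hG'c hg'c hh'c
  have hparts := intervalIntegral.integral_mul_deriv_eq_deriv_mul
    (fun t ht => (hg t ht).ofReal_comp) hG
    (Complex.continuous_ofReal.comp_continuousOn hg'c).intervalIntegrable hG'c.intervalIntegrable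
  have hint : ‖∫ t in a..b, (g' t : ℂ) * G t‖ ≤ h b - h a := by
    rw [← intervalIntegral.integral_eq_sub_of_hasDerivAt hh hh'c.intervalIntegrable]
    refine intervalIntegral.norm_integral_le_of_norm_le hab (ae_of_all _ fun t ht => ?_)
      hh'c.intervalIntegrable
    have ht' := Ioc_subset_Icc_self ht
    rw [norm_mul, Complex.norm_real, Real.norm_eq_abs]
    calc |g' t| * ‖G t‖ ≤ |g' t| * 1 := by gcongr; exact hG1 t ht'
      _ ≤ h' t := by rw [mul_one]; exact hgh t ht'
  have hend : ∀ t ∈ Icc a b, ‖(g t : ℂ) * G t‖ ≤ |g t| := by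
    intro t ht
    rw [norm_mul, Complex.norm_real, Real.norm_eq_abs]
    exact mul_le_of_le_one_right (abs_nonneg _) (hG1 t ht)
  rw [hparts]
  have h1 := hend a (left_mem_Icc.mpr hab)
  have h2 := hend b (right_mem_Icc.mpr hab)
  calc _ ≤ ‖(g b : ℂ) * G b‖ + ‖(g a : ℂ) * G a‖ + ‖∫ t in a..b, (g' t : ℂ) * G t‖ :=
        (norm_sub_le _ _).trans (add_le_add_left (norm_sub_le _ _) _)
    _ ≤ _ := by linarith

/-- The integrand of `oscInt`. -/
def oscKernel (c₃ c₄ l z t : ℝ) : ℂ :=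
  Complex.exp (-(Complex.I * l * (c₃ * (t : ℂ) ^ 3 - z * t)) - c₄ * (t : ℂ) ^ 4)

/-- The unimodular factor `e^{-iλ(c₃t³ - zt)}`. -/
def oscPhase (c₃ l z t : ℝ) : ℂ :=
  Complex.exp (((-(l * (c₃ * t ^ 3 - z * t)) : ℝ) : ℂ) * Complex.I)

theorem norm_oscPhase (c₃ l z t : ℝ) : ‖oscPhase c₃ l z t‖ = 1 := by
  rw [oscPhase, Complex.norm_exp_ofReal_mul_I]

theorem oscKernel_eq (c₃ c₄ l z t : ℝ) :
    oscKernel c₃ c₄ l z t = oscPhase c₃ l z t * (Real.exp (-c₄ * t ^ 4) : ℝ) := by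
  rw [oscKernel, oscPhase, Complex.ofReal_exp, ← Complex.exp_add]
  congr 1
  push_cast
  ring

theorem continuous_oscPhase (c₃ l z : ℝ) : Continuous (oscPhase c₃ l z) := by
  unfold oscPhase
  fun_prop

theorem continuous_oscKernel (c₃ c₄ l z : ℝ) : Continuous (oscKernel c₃ c₄ l z) := by
  unfold oscKernel
  fun_prop

theorem norm_oscKernel (c₃ c₄ l z t : ℝ) :
    ‖oscKernel c₃ c₄ l z t‖ = Real.exp (-c₄ * t ^ 4) := by
  rw [oscKernel_eq, norm_mul, norm_oscPhase, one_mul, Complex.norm_real,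
    Real.norm_of_nonneg (Real.exp_pos _).le]

theorem integrable_oscKernel {c₄ : ℝ} (hc₄ : 0 < c₄) (c₃ l z : ℝ) :
    Integrable (oscKernel c₃ c₄ l z) := by
  refine (integrable_abs_pow_mul_exp_quartic hc₄ 0).mono'
    (continuous_oscKernel _ _ _ _).aestronglyMeasurable (ae_of_all _ fun t => ?_)
  rw [norm_oscKernel, pow_zero, one_mul]

/-- The kernel at `-t` is the conjugate of the kernel at `t`, so only the half-line, with at most
one stationary point, has to be analysed. -/
theorem oscInt_eq_two_mul_re {c₄ : ℝ} (hc₄ : 0 < c₄) (c₃ l z : ℝ) :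
    oscInt c₃ c₄ l z = ((2 * (∫ t in Ioi (0 : ℝ), oscKernel c₃ c₄ l z t).re : ℝ) : ℂ) := by
  have hint := integrable_oscKernel hc₄ c₃ l z
  have hconj : ∀ t, oscKernel c₃ c₄ l z (-t) = (starRingEnd ℂ) (oscKernel c₃ c₄ l z t) := by
    intro t
    rw [oscKernel, oscKernel, ← Complex.exp_conj]
    congr 1
    simp
    ring
  have hneg : ∫ t in Iic (0 : ℝ), oscKernel c₃ c₄ l z t =
      (starRingEnd ℂ) (∫ t in Ioi (0 : ℝ), oscKernel c₃ c₄ l z t) := by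
    rw [← integral_conj]
    have := integral_comp_neg_Ioi (0 : ℝ) (oscKernel c₃ c₄ l z)
    rw [neg_zero] at this
    rw [← this]
    simp only [hconj]
  have hsplit : oscInt c₃ c₄ l z = (∫ t in Iic (0 : ℝ), oscKernel c₃ c₄ l z t) +
      ∫ t in Ioi (0 : ℝ), oscKernel c₃ c₄ l z t :=
    (intervalIntegral.integral_Iic_add_Ioi hint.integrableOn hint.integrableOn).symm
  rw [hsplit, hneg, add_comm, Complex.add_conj]

/-- First-derivative test: the kernel is the derivative of the unimodular phase times `f · k` up to
the constant `-il`, where `f` is the quartic weight and `k` the inverse of the phase derivative `p`.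
On `t ≥ 0` both factors are nonincreasing, since `p` increases without vanishing. -/
theorem norm_integral_oscKernel_le {c₃ c₄ l z m a b : ℝ} (hc₃ : 0 < c₃) (hc₄ : 0 < c₄)
    (hl : 0 < l) (hm : 0 < m) (ha : 0 ≤ a) (hab : a ≤ b)
    (hp : ∀ t ∈ Icc a b, m ≤ |3 * c₃ * t ^ 2 - z|) :
    ‖∫ t in a..b, oscKernel c₃ c₄ l z t‖ ≤ 5 / (l * m) := by
  set f : ℝ → ℝ := fun t => Real.exp (-c₄ * t ^ 4) with hf
  set f' : ℝ → ℝ := fun t => Real.exp (-c₄ * t ^ 4) * (-c₄ * (4 * t ^ 3)) with hf'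
  set p : ℝ → ℝ := fun t => 3 * c₃ * t ^ 2 - z with hpdef
  set k : ℝ → ℝ := fun t => (p t)⁻¹ with hk
  set k' : ℝ → ℝ := fun t => -(3 * c₃ * (2 * t)) / p t ^ 2 with hk'
  have hp0 : ∀ t ∈ Icc a b, p t ≠ 0 := fun t ht h => by
    have := hp t ht
    change m ≤ |p t| at this
    rw [h, abs_zero] at this
    linarith
  have hfd : ∀ t, HasDerivAt f (f' t) t := fun t => by
    have := ((hasDerivAt_pow 4 t).const_mul (-c₄)).exp
    simpa [hf, hf'] using this
  have hpd : ∀ t, HasDerivAt p (3 * c₃ * (2 * t)) t := fun t => by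
    have := ((hasDerivAt_pow 2 t).const_mul (3 * c₃)).sub_const z
    simpa [hpdef] using this
  have hkd : ∀ t ∈ Icc a b, HasDerivAt k (k' t) t := fun t ht => (hpd t).fun_inv (hp0 t ht)
  have hkm : ∀ t ∈ Icc a b, |k t| ≤ 1 / m := fun t ht => by
    rw [hk, abs_inv, ← one_div]
    exact one_div_le_one_div_of_le hm (hp t ht)
  have hf01 : ∀ t, 0 < f t ∧ f t ≤ 1 := fun t =>
    ⟨Real.exp_pos _, Real.exp_le_one_iff.mpr (by nlinarith [show 0 ≤ t ^ 4 by positivity])⟩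
  have hfc : Continuous f := by fun_prop
  have hf'c : Continuous f' := by fun_prop
  have hpc : Continuous p := by fun_prop
  have hkc : ContinuousOn k (Icc a b) := hpc.continuousOn.inv₀ hp0
  have hk'c : ContinuousOn k' (Icc a b) :=
    ContinuousOn.div (by fun_prop) (by fun_prop) fun t ht => pow_ne_zero 2 (hp0 t ht)
  have hGd : ∀ t, HasDerivAt (oscPhase c₃ l z)
      (oscPhase c₃ l z t * (((-(l * p t) : ℝ) : ℂ) * Complex.I)) t := fun t => by
    have h1 : HasDerivAt (fun t : ℝ => -(l * (c₃ * t ^ 3 - z * t))) (-(l * p t)) t := by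
      have := ((((hasDerivAt_pow 3 t).const_mul c₃).sub
        ((hasDerivAt_id t).const_mul z)).const_mul l).neg
      convert! this using 1
      simp [hpdef]
      left
      ring
    exact (h1.ofReal_comp.mul_const Complex.I).cexp
  have hmain := norm_integral_deriv_mul_le hab (fun t _ => hGd t)
    (fun t ht => (hfd t).mul (hkd t ht))
    -- Bounds `|(fk)'|` using `|k| ≤ 1/m` and `0 < f ≤ 1`. The two endpoint terms give `2/m`, the
    -- `f` part of the variation at most `1/m` and the `k` part at most `2/m`, whence the constant
    -- 5.
    (h := fun t => -(f t / m) - k t) (h' := fun t => -(f' t / m) - k' t)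
    (fun t ht => ((hfd t).div_const m).neg.sub (hkd t ht))
    (by have := continuous_oscPhase c₃ l z; fun_prop)
    (by fun_prop) (by fun_prop) (fun t _ => (norm_oscPhase _ _ _ _).le)
    (fun t ht => by
      have ht0 : 0 ≤ t := ha.trans ht.1
      have hf'0 : f' t ≤ 0 := by
        have h1 : 0 ≤ Real.exp (-c₄ * t ^ 4) * (c₄ * (4 * t ^ 3)) := by positivity
        simp only [hf']
        linarith
      have hk'0 : k' t ≤ 0 := by
        simp only [hk', neg_div]
        have : 0 ≤ 3 * c₃ * (2 * t) / p t ^ 2 := by positivity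
        linarith
      have h1 : |f' t * k t| ≤ -(f' t / m) := by
        rw [abs_mul, abs_of_nonpos hf'0]
        calc -f' t * |k t| ≤ -f' t * (1 / m) := by
              gcongr
              · linarith
              · exact hkm t ht
          _ = _ := by ring
      have h2 : |f t * k' t| ≤ -k' t := by
        rw [abs_mul, abs_of_nonpos hk'0, abs_of_pos (hf01 t).1]
        exact mul_le_of_le_one_left (by linarith) (hf01 t).2
      calc |f' t * k t + f t * k' t| ≤ |f' t * k t| + |f t * k' t| := abs_add_le _ _
        _ ≤ _ := by linarith)
  have hrew : ∫ t in a..b, ((f * k) t : ℂ) *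
      (oscPhase c₃ l z t * (((-(l * p t) : ℝ) : ℂ) * Complex.I)) =
      (-(l : ℂ) * Complex.I) * ∫ t in a..b, oscKernel c₃ c₄ l z t := by
    rw [← intervalIntegral.integral_const_mul]
    refine intervalIntegral.integral_congr fun t ht => ?_
    rw [uIcc_of_le hab] at ht
    have hpC : (p t : ℂ) ≠ 0 := by exact_mod_cast hp0 t ht
    simp only [Pi.mul_apply, hk, oscKernel_eq]
    push_cast
    simp only [hf]
    push_cast
    field_simp
  rw [hrew, norm_mul, norm_mul, norm_neg, Complex.norm_real, Complex.norm_I, mul_one,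
    Real.norm_of_nonneg hl.le] at hmain
  have ha' := left_mem_Icc.mpr hab
  have hb' := right_mem_Icc.mpr hab
  have hgm : ∀ t ∈ Icc a b, |(f * k) t| ≤ 1 / m := fun t ht => by
    rw [Pi.mul_apply, abs_mul, abs_of_pos (hf01 t).1]
    exact (mul_le_of_le_one_left (abs_nonneg _) (hf01 t).2).trans (hkm t ht)
  have h1 := hgm a ha'
  have h2 := hgm b hb'
  have h3 := abs_le.mp (hkm a ha')
  have h4 := abs_le.mp (hkm b hb')
  have h5 : f a / m ≤ 1 / m := by gcongr; exact (hf01 a).2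
  have h6 : 0 ≤ f b / m := div_nonneg (hf01 b).1.le hm.le
  rw [← div_div, div_right_comm, le_div_iff₀' hl]
  calc _ ≤ _ := hmain
    _ ≤ 5 * (1 / m) := by linarith
    _ = 5 / m := by ring

theorem norm_integral_Ioi_oscKernel_le {c₃ c₄ l z m a : ℝ} (hc₃ : 0 < c₃) (hc₄ : 0 < c₄)
    (hl : 0 < l) (hm : 0 < m) (ha : 0 ≤ a)
    (hp : ∀ t, a ≤ t → m ≤ |3 * c₃ * t ^ 2 - z|) :
    ‖∫ t in Ioi a, oscKernel c₃ c₄ l z t‖ ≤ 5 / (l * m) := by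
  have hlim := (intervalIntegral_tendsto_integral_Ioi a
    (integrable_oscKernel hc₄ c₃ l z).integrableOn tendsto_id).norm
  refine le_of_tendsto hlim ?_
  filter_upwards [eventually_ge_atTop a] with b hb
  exact norm_integral_oscKernel_le hc₃ hc₄ hl hm ha hb fun t ht => hp t ht.1

theorem norm_oscInt_le_of_neg {c₃ c₄ l z : ℝ} (hc₃ : 0 < c₃) (hc₄ : 0 < c₄)
    (hl : 0 < l) (hz : z < 0) : ‖oscInt c₃ c₄ l z‖ ≤ 10 / (l * -z) := by
  have h := norm_integral_Ioi_oscKernel_le (l := l) (z := z) (m := -z) hc₃ hc₄ hl (by linarith)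
    le_rfl (fun t _ => by
      rw [abs_of_pos (by nlinarith [show 0 ≤ c₃ * t ^ 2 by positivity])]
      nlinarith [show 0 ≤ c₃ * t ^ 2 by positivity])
  rw [oscInt_eq_two_mul_re hc₄, Complex.norm_real, norm_mul, Real.norm_ofNat, Real.norm_eq_abs]
  calc 2 * |(∫ t in Ioi (0 : ℝ), oscKernel c₃ c₄ l z t).re| ≤ 2 * (5 / (l * -z)) := by
        gcongr
        exact (Complex.abs_re_le_norm _).trans h
    _ = _ := by ring

/-! ### The Fresnel integral -/

/-- The bound involves `‖β‖` and not `β.re`, so it survives the limit to purely imaginary `β`. -/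
theorem norm_integral_exp_neg_mul_sq_le {β : ℂ} (hβ : 0 < β.re) {d b : ℝ} (hd : 0 < d)
    (hdb : d ≤ b) : ‖∫ r in d..b, Complex.exp (-β * (r : ℂ) ^ 2)‖ ≤ 1 / (‖β‖ * d) := by
  have hβ0 : β ≠ 0 := by rintro rfl; simp at hβ
  have hpos : ∀ t ∈ Icc d b, t ≠ 0 := fun t ht => (hd.trans_le ht.1).ne'
  have hmain := norm_integral_deriv_mul_le (G := fun r : ℝ => Complex.exp (-β * (r : ℂ) ^ 2))
    (G' := fun r : ℝ => Complex.exp (-β * (r : ℂ) ^ 2) * (-β * (2 * (r : ℂ))))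
    (g := fun r => r⁻¹) (g' := fun r => -(r ^ 2)⁻¹) (h := fun r => -r⁻¹)
    (h' := fun r => - -(r ^ 2)⁻¹) hdb
    (fun t _ => by
      have h1 := ((hasDerivAt_id t).ofReal_comp.pow 2).const_mul (-β)
      have h2 := h1.cexp
      simpa using h2)
    (fun t ht => hasDerivAt_inv (hpos t ht)) (fun t ht => (hasDerivAt_inv (hpos t ht)).neg)
    (by fun_prop)
    (ContinuousOn.neg (ContinuousOn.inv₀ (by fun_prop) fun t ht => pow_ne_zero 2 (hpos t ht)))
    (ContinuousOn.neg
      (ContinuousOn.neg (ContinuousOn.inv₀ (by fun_prop) fun t ht => pow_ne_zero 2 (hpos t ht))))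
    (fun t _ => by
      rw [Complex.norm_exp, ← Complex.ofReal_pow, Complex.re_mul_ofReal, Complex.neg_re]
      exact Real.exp_le_one_iff.mpr (by nlinarith [sq_nonneg t]))
    (fun t _ => by
      rw [neg_neg, abs_neg, abs_of_nonneg (by positivity)])
  have hrew : ∫ r in d..b, ((r⁻¹ : ℝ) : ℂ) *
      (Complex.exp (-β * (r : ℂ) ^ 2) * (-β * (2 * (r : ℂ)))) =
      (-β * 2) * ∫ r in d..b, Complex.exp (-β * (r : ℂ) ^ 2) := by
    rw [← intervalIntegral.integral_const_mul]
    refine intervalIntegral.integral_congr fun t ht => ?_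
    rw [uIcc_of_le hdb] at ht
    have htC : (t : ℂ) ≠ 0 := by exact_mod_cast hpos t ht
    push_cast
    field_simp
  rw [hrew, norm_mul, norm_mul, norm_neg, Complex.norm_ofNat,
    abs_of_pos (inv_pos.mpr hd), abs_of_pos (inv_pos.mpr (hd.trans_le hdb))] at hmain
  have hβn : 0 < ‖β‖ := norm_pos_iff.mpr hβ0
  rw [← div_div, div_right_comm, le_div_iff₀' hβn, one_div]
  linarith

theorem norm_integral_exp_neg_mul_sq_sub_le_of_re_pos {β : ℂ} (hβ : 0 < β.re) {d : ℝ}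
    (hd : 0 < d) :
    ‖(∫ r in (0 : ℝ)..d, Complex.exp (-β * (r : ℂ) ^ 2)) - (Real.pi / β) ^ (1 / 2 : ℂ) / 2‖ ≤
      1 / (‖β‖ * d) := by
  have hint := integrable_cexp_neg_mul_sq hβ
  have hlim := intervalIntegral_tendsto_integral_Ioi (0 : ℝ) hint.integrableOn tendsto_id
  rw [integral_gaussian_complex_Ioi hβ] at hlim
  have hlim2 := (tendsto_const_nhds (x := ∫ r in (0 : ℝ)..d, Complex.exp (-β * (r : ℂ) ^ 2))
    |>.sub hlim).norm
  refine le_of_tendsto hlim2 ?_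
  filter_upwards [eventually_ge_atTop d] with b hb
  have hc : Continuous fun r : ℝ => Complex.exp (-β * (r : ℂ) ^ 2) := by fun_prop
  rw [id, ← intervalIntegral.integral_add_adjacent_intervals (hc.intervalIntegrable 0 d)
    (hc.intervalIntegrable d b), sub_add_cancel_left, norm_neg]
  exact norm_integral_exp_neg_mul_sq_le hβ hd hb

theorem cpow_half_pi_div_I_mul {B : ℝ} (hB : 0 < B) :
    (Real.pi / (Complex.I * B) : ℂ) ^ (1 / 2 : ℂ) =
      (√(Real.pi / B) : ℝ) * Complex.exp (-(Real.pi / 4 : ℝ) * Complex.I) := by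
  have hpi := Real.pi_pos
  have hq : 0 < Real.pi / B := div_pos hpi hB
  have hBC : (B : ℂ) ≠ 0 := by exact_mod_cast hB.ne'
  have h1 : (Real.pi / (Complex.I * B) : ℂ) = ((Real.pi / B : ℝ) : ℂ) * -Complex.I := by
    push_cast
    field_simp
    linear_combination Complex.I_mul_I
  have hne : ((Real.pi / B : ℝ) : ℂ) * -Complex.I ≠ 0 :=
    mul_ne_zero (by exact_mod_cast hq.ne') (by simp)
  rw [h1, Complex.cpow_def_of_ne_zero hne, Complex.log_ofReal_mul hq (by simp),
    Complex.log_neg_I, Real.sqrt_eq_rpow, Real.rpow_def_of_pos hq, Complex.ofReal_exp,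
    ← Complex.exp_add]
  congr 1
  push_cast
  ring

/-- The Gaussian formula needs a positive real part, so `e > 0` is added to `iB` and then sent to 0.
The truncation bound is uniform in `e`, and the square root is continuous there because `π / (iB)`
lies on the negative imaginary axis, off the branch cut. -/
theorem norm_fresnel_sub_le {B d : ℝ} (hB : 0 < B) (hd : 0 < d) :
    ‖(∫ r in (0 : ℝ)..d, Complex.exp (-(Complex.I * B) * (r : ℂ) ^ 2)) -
      (√(Real.pi / B) : ℝ) * Complex.exp (-(Real.pi / 4 : ℝ) * Complex.I) / 2‖ ≤
      1 / (B * d) := by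
  have hBC : (B : ℂ) ≠ 0 := by exact_mod_cast hB.ne'
  set β : ℝ → ℂ := fun e => e + Complex.I * B with hβ
  have hβc : Continuous β := by fun_prop
  have hβ0 : β 0 = Complex.I * B := by simp [hβ]
  have hslit : (Real.pi / (Complex.I * B) : ℂ) ∈ Complex.slitPlane := by
    rw [Complex.mem_slitPlane_iff]
    right
    have : (Real.pi / (Complex.I * B) : ℂ) = ((-(Real.pi / B) : ℝ) : ℂ) * Complex.I := by
      push_cast
      field_simp
      linear_combination Complex.I_mul_I
    rw [this, Complex.im_ofReal_mul, Complex.I_im, mul_one]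
    exact neg_ne_zero.mpr (div_pos Real.pi_pos hB).ne'
  have hcont1 : Continuous fun e : ℝ =>
      ∫ r in (0 : ℝ)..d, Complex.exp (-(β e) * (r : ℂ) ^ 2) := by
    apply intervalIntegral.continuous_parametric_intervalIntegral_of_continuous'
    fun_prop
  have hcont2 : ContinuousAt (fun e : ℝ => (Real.pi / β e) ^ (1 / 2 : ℂ)) 0 := by
    refine ContinuousAt.cpow ?_ continuousAt_const (by rw [hβ0]; exact hslit)
    exact continuousAt_const.div hβc.continuousAt (by rw [hβ0]; simp [hBC])
  have hlim : Tendsto (fun e : ℝ => ‖(∫ r in (0 : ℝ)..d, Complex.exp (-(β e) * (r : ℂ) ^ 2)) -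
      (Real.pi / β e) ^ (1 / 2 : ℂ) / 2‖) (𝓝[>] 0)
      (𝓝 ‖(∫ r in (0 : ℝ)..d, Complex.exp (-(β 0) * (r : ℂ) ^ 2)) -
      (Real.pi / β 0) ^ (1 / 2 : ℂ) / 2‖) :=
    ((hcont1.continuousAt.sub (hcont2.div_const 2)).norm.tendsto).mono_left nhdsWithin_le_nhds
  rw [hβ0, cpow_half_pi_div_I_mul hB] at hlim
  refine le_of_tendsto hlim ?_
  filter_upwards [self_mem_nhdsWithin] with e he
  have hre : (β e).re = e := by simp [hβ]
  have him : (β e).im = B := by simp [hβ]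
  refine (norm_integral_exp_neg_mul_sq_sub_le_of_re_pos (by rw [hre]; exact he) hd).trans ?_
  have : B ≤ ‖β e‖ := by
    have := Complex.abs_im_le_norm (β e)
    rwa [him, abs_of_pos hB] at this
  gcongr

/-! ### Stationary phase -/

theorem abs_exp_quartic_sub_le {c₄ s r R : ℝ} (hc₄ : 0 < c₄) (hs : |s| ≤ R)
    (hr : |s + r| ≤ R) :
    |Real.exp (-c₄ * (s + r) ^ 4) - Real.exp (-c₄ * s ^ 4)| ≤ 4 * c₄ * R ^ 3 * |r| := by
  have hexp : ∀ x y : ℝ, 0 ≤ x → x ≤ y → |Real.exp (-x) - Real.exp (-y)| ≤ y - x := by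
    intro x y hx hxy
    have h1 : Real.exp (-y) ≤ Real.exp (-x) := by gcongr
    have h2 : Real.exp (-y) = Real.exp (-x) * Real.exp (-(y - x)) := by
      rw [← Real.exp_add]
      ring_nf
    have h3 := Real.add_one_le_exp (-(y - x))
    have h4 : Real.exp (-x) ≤ 1 := Real.exp_le_one_iff.mpr (by linarith)
    have h5 := Real.exp_pos (-x)
    rw [abs_of_nonneg (by linarith), h2]
    nlinarith
  have hexp' : ∀ x y : ℝ, 0 ≤ x → 0 ≤ y → |Real.exp (-x) - Real.exp (-y)| ≤ |x - y| := by
    intro x y hx hy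
    rcases le_total x y with h | h
    · rw [abs_sub_comm x y, abs_of_nonneg (sub_nonneg.mpr h)]
      exact hexp x y hx h
    · rw [abs_sub_comm (Real.exp _), abs_of_nonneg (sub_nonneg.mpr h)]
      exact hexp y x hy h
  have h1 := hexp' (c₄ * (s + r) ^ 4) (c₄ * s ^ 4) (by positivity) (by positivity)
  rw [← neg_mul, ← neg_mul, ← mul_sub, abs_mul, abs_of_pos hc₄] at h1
  have h2 := abs_pow_sub_pow_le (s + r) s 4
  rw [add_sub_cancel_left] at h2
  have h3 : max |s + r| |s| ≤ R := max_le hr hs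
  calc _ ≤ c₄ * |(s + r) ^ 4 - s ^ 4| := h1
    _ ≤ c₄ * (|r| * 4 * R ^ 3) := by
      gcongr
      refine h2.trans ?_
      norm_num
      gcongr
    _ = _ := by ring

/-- The choice `z = 3c₃s²` makes `s` stationary, and the phase is a cubic polynomial, so its
expansion at `s` is exactly a quadratic term plus `c₃r³`. -/
theorem oscKernel_add {c₃ c₄ l s r : ℝ} :
    oscKernel c₃ c₄ l (3 * c₃ * s ^ 2) (s + r) =
      oscPhase c₃ l (3 * c₃ * s ^ 2) s *
        (Complex.exp (-(Complex.I * (3 * l * c₃ * s : ℝ)) * (r : ℂ) ^ 2) *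
        (Complex.exp (Complex.I * (-(l * c₃ * r ^ 3) : ℝ)) *
          (Real.exp (-c₄ * (s + r) ^ 4) : ℝ))) := by
  rw [oscKernel_eq, oscPhase, oscPhase, ← mul_assoc, ← mul_assoc, ← Complex.exp_add,
    ← Complex.exp_add]
  congr 2
  push_cast
  ring

/-- The half-line is cut at `s ± d`. On the two outer pieces the phase derivative is at least
`3c₃ds`, which costs `10 / (Bd)` with `B = 3lc₃s`. On the window the cubic phase is dropped and the
weight frozen at `s`; completing the resulting Fresnel integral costs `2 / (Bd)`. The width `d` is
left free for later balancing. -/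
theorem norm_integral_Ioi_oscKernel_sub_le {c₃ c₄ l s d : ℝ} (hc₃ : 0 < c₃) (hc₄ : 0 < c₄)
    (hl : 0 < l) (hd : 0 < d) (hds : d ≤ s) :
    ‖(∫ t in Ioi (0 : ℝ), oscKernel c₃ c₄ l (3 * c₃ * s ^ 2) t) -
      oscPhase c₃ l (3 * c₃ * s ^ 2) s * (Real.exp (-c₄ * s ^ 4) : ℝ) *
        ((√(Real.pi / (3 * l * c₃ * s)) : ℝ) * Complex.exp (-(Real.pi / 4 : ℝ) * Complex.I))‖ ≤
      12 / (3 * l * c₃ * s * d) + 2 * d * (l * c₃ * d ^ 3 + 4 * c₄ * (s + d) ^ 3 * d) := by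
  have hs : 0 < s := hd.trans_le hds
  set z := 3 * c₃ * s ^ 2 with hz
  set B := 3 * l * c₃ * s with hB
  have hBpos : 0 < B := by positivity
  have hint := integrable_oscKernel hc₄ c₃ l z
  have hcont := continuous_oscKernel c₃ c₄ l z
  have hsplit : ∫ t in Ioi (0 : ℝ), oscKernel c₃ c₄ l z t =
      (∫ t in (0 : ℝ)..(s - d), oscKernel c₃ c₄ l z t) +
      (∫ t in (s - d)..(s + d), oscKernel c₃ c₄ l z t) +
      ∫ t in Ioi (s + d), oscKernel c₃ c₄ l z t := by
    rw [intervalIntegral.integral_add_adjacent_intervals (hcont.intervalIntegrable _ _)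
      (hcont.intervalIntegrable _ _), intervalIntegral.integral_interval_add_Ioi
      hint.integrableOn hint.integrableOn]
  have hfac : ∀ t : ℝ, 3 * c₃ * t ^ 2 - z = 3 * c₃ * ((t - s) * (t + s)) := fun t => by
    rw [hz]; ring
  have hm : 0 < 3 * c₃ * (d * s) := by positivity
  have hI1 : ‖∫ t in (0 : ℝ)..(s - d), oscKernel c₃ c₄ l z t‖ ≤ 5 / (l * (3 * c₃ * (d * s))) := by
    refine norm_integral_oscKernel_le hc₃ hc₄ hl hm le_rfl (by linarith) fun t ht => ?_
    rw [hfac, abs_mul, abs_of_pos (by positivity : 0 < 3 * c₃), abs_mul,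
      abs_of_nonpos (by linarith [ht.2]), abs_of_pos (by linarith [ht.1])]
    have := ht.1
    have := ht.2
    gcongr <;> linarith
  have hI3 : ‖∫ t in Ioi (s + d), oscKernel c₃ c₄ l z t‖ ≤ 5 / (l * (3 * c₃ * (d * s))) := by
    refine norm_integral_Ioi_oscKernel_le hc₃ hc₄ hl hm (by linarith) fun t ht => ?_
    rw [hfac, abs_mul, abs_of_pos (by positivity : 0 < 3 * c₃), abs_mul,
      abs_of_nonneg (by linarith), abs_of_pos (by linarith)]
    gcongr <;> linarith
  have hshift : ∫ t in (s - d)..(s + d), oscKernel c₃ c₄ l z t =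
      ∫ r in (-d)..d, oscKernel c₃ c₄ l z (s + r) := by
    rw [intervalIntegral.integral_comp_add_left (fun t => oscKernel c₃ c₄ l z t) s, sub_eq_add_neg]
  set A : ℂ := oscPhase c₃ l z s * (Real.exp (-c₄ * s ^ 4) : ℝ) with hA
  set F : ℝ → ℂ := fun r => Complex.exp (-(Complex.I * B) * (r : ℂ) ^ 2) with hF
  have hFc : Continuous F := by fun_prop
  have hFn : ∀ r, ‖F r‖ = 1 := fun r => by
    have : -(Complex.I * B) * (r : ℂ) ^ 2 = ((-(B * r ^ 2) : ℝ) : ℂ) * Complex.I := by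
      push_cast; ring
    simp only [hF, this, Complex.norm_exp_ofReal_mul_I]
  have hAn : ‖A‖ ≤ 1 := by
    rw [hA, norm_mul, norm_oscPhase, one_mul, Complex.norm_real,
      Real.norm_of_nonneg (Real.exp_pos _).le]
    exact Real.exp_le_one_iff.mpr (by nlinarith [show 0 ≤ s ^ 4 by positivity])
  have hmid : ‖(∫ r in (-d)..d, oscKernel c₃ c₄ l z (s + r)) - ∫ r in (-d)..d, A * F r‖ ≤
      (l * c₃ * d ^ 3 + 4 * c₄ * (s + d) ^ 3 * d) * |d - -d| := by
    have hc1 : Continuous fun r => oscKernel c₃ c₄ l z (s + r) := hcont.comp (by fun_prop)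
    have hc2 : Continuous fun r => A * F r := continuous_const.mul hFc
    rw [← intervalIntegral.integral_sub (hc1.intervalIntegrable _ _) (hc2.intervalIntegrable _ _)]
    refine intervalIntegral.norm_integral_le_of_norm_le_const fun r hr => ?_
    rw [uIoc_of_le (by linarith)] at hr
    have hrd : |r| ≤ d := abs_le.mpr ⟨hr.1.le, hr.2⟩
    have hrs : |s + r| ≤ s + d := by
      rw [abs_of_nonneg (by linarith [hr.1])]
      linarith [hr.2]
    have hLip := abs_exp_quartic_sub_le hc₄ (by rw [abs_of_pos hs]; linarith) hrs
    have he := Real.norm_exp_I_mul_ofReal_sub_one_le (x := -(l * c₃ * r ^ 3))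
    have hAF : oscKernel c₃ c₄ l z (s + r) - A * F r = oscPhase c₃ l z s * (F r *
        ((Complex.exp (Complex.I * (-(l * c₃ * r ^ 3) : ℝ)) - 1) *
          (Real.exp (-c₄ * (s + r) ^ 4) : ℝ) +
          ((Real.exp (-c₄ * (s + r) ^ 4) - Real.exp (-c₄ * s ^ 4) : ℝ) : ℂ))) := by
      rw [hz, oscKernel_add, ← hz, hA]
      simp only [hF]
      rw [Complex.ofReal_sub]
      ring
    rw [hAF, norm_mul, norm_mul, norm_oscPhase, hFn, one_mul, one_mul]
    refine (norm_add_le _ _).trans ?_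
    rw [norm_mul, Complex.norm_real, Complex.norm_real, Real.norm_of_nonneg (Real.exp_pos _).le]
    refine add_le_add ?_ ?_
    · have h1 : Real.exp (-c₄ * (s + r) ^ 4) ≤ 1 :=
        Real.exp_le_one_iff.mpr (by nlinarith [show 0 ≤ (s + r) ^ 4 by positivity])
      refine (mul_le_of_le_one_right (norm_nonneg _) h1).trans (he.trans ?_)
      rw [norm_neg, Real.norm_eq_abs, abs_mul, abs_of_pos (by positivity : 0 < l * c₃), abs_pow]
      gcongr
    · rw [Real.norm_eq_abs]
      refine hLip.trans ?_
      gcongr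
  have heven : ∫ r in (-d)..d, A * F r = A * (2 * ∫ r in (0 : ℝ)..d, F r) := by
    rw [intervalIntegral.integral_const_mul, ← intervalIntegral.integral_add_adjacent_intervals
      (hFc.intervalIntegrable (-d) 0) (hFc.intervalIntegrable 0 d)]
    have h1 := intervalIntegral.integral_comp_neg (a := 0) (b := d) F
    have h2 : ∀ r, F (-r) = F r := fun r => by simp [hF]
    simp only [h2, neg_zero] at h1
    rw [← h1]
    ring
  have hfres := norm_fresnel_sub_le hBpos hd
  set G : ℂ := (√(Real.pi / B) : ℝ) * Complex.exp (-(Real.pi / 4 : ℝ) * Complex.I) with hG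
  have hmod : ‖(∫ r in (-d)..d, A * F r) - A * G‖ ≤ 2 / (B * d) := by
    rw [heven, show A * (2 * ∫ r in (0 : ℝ)..d, F r) - A * G =
      A * 2 * ((∫ r in (0 : ℝ)..d, F r) - G / 2) by ring, norm_mul, norm_mul, Complex.norm_ofNat]
    calc _ ≤ 1 * 2 * (1 / (B * d)) := by gcongr
      _ = _ := by ring
  rw [hsplit, hshift]
  have hdec : ∀ x y w v u : ℂ, x + y + w - u = x + w + (y - v) + (v - u) := by
    intros; ring
  rw [hdec _ _ _ (∫ r in (-d)..d, A * F r)]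
  refine (norm_add_le _ _).trans ?_
  have h5 : 5 / (l * (3 * c₃ * (d * s))) = 5 / (B * d) := by
    rw [hB]
    congr 1
    ring
  rw [h5] at hI1 hI3
  have habs : |d - -d| = 2 * d := by
    rw [sub_neg_eq_add, ← two_mul, abs_of_pos (by linarith)]
  rw [habs] at hmid
  calc _ ≤ (5 / (B * d) + 5 / (B * d)) +
        (l * c₃ * d ^ 3 + 4 * c₄ * (s + d) ^ 3 * d) * (2 * d) + 2 / (B * d) := by
        refine add_le_add ((norm_add_le _ _).trans (add_le_add ?_ hmid)) hmod
        exact (norm_add_le _ _).trans (add_le_add hI1 hI3)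
    _ = _ := by ring

/-- The stationary point of the phase. -/
def statPoint (c₃ z : ℝ) : ℝ := √(z / (3 * c₃))

/-- The amplitude of the asymptotic profile. -/
def profileAmp (c₃ c₄ z : ℝ) : ℝ :=
  2 * Real.exp (-c₄ * statPoint c₃ z ^ 4) * √(Real.pi / (3 * c₃ * statPoint c₃ z))

/-- The phase of the asymptotic profile. -/
def profilePhase (c₃ z : ℝ) : ℝ := 2 * c₃ * statPoint c₃ z ^ 3

theorem abs_norm_oscInt_sub_le {c₃ c₄ l z d : ℝ} (hc₃ : 0 < c₃) (hc₄ : 0 < c₄)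
    (hl : 0 < l) (hz : 0 < z) (hd : 0 < d) (hds : d ≤ statPoint c₃ z) :
    |‖oscInt c₃ c₄ l z‖ -
      profileAmp c₃ c₄ z * |Real.cos (l * profilePhase c₃ z - Real.pi / 4)| / √l| ≤
      2 * (12 / (3 * l * c₃ * statPoint c₃ z * d) +
        2 * d * (l * c₃ * d ^ 3 + 4 * c₄ * (statPoint c₃ z + d) ^ 3 * d)) := by
  set s := statPoint c₃ z with hs
  have hspos : 0 < s := hd.trans_le hds
  have hzs : z = 3 * c₃ * s ^ 2 := by
    rw [hs, statPoint, Real.sq_sqrt (by positivity)]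
    field_simp
  have hmain := norm_integral_Ioi_oscKernel_sub_le hc₃ hc₄ hl hd hds
  rw [← hzs] at hmain
  have hre := (Complex.abs_re_le_norm _).trans hmain
  rw [Complex.sub_re] at hre
  -- The critical value of the phase is `c₃s³ - zs = -2c₃s³`, which supplies the argument of the
  -- cosine.
  have hval : (oscPhase c₃ l z s * (Real.exp (-c₄ * s ^ 4) : ℝ) *
        ((√(Real.pi / (3 * l * c₃ * s)) : ℝ) *
          Complex.exp (-(Real.pi / 4 : ℝ) * Complex.I))).re =
      Real.exp (-c₄ * s ^ 4) * √(Real.pi / (3 * l * c₃ * s)) *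
        Real.cos (l * (2 * c₃ * s ^ 3) - Real.pi / 4) := by
    have h1 : oscPhase c₃ l z s * (Real.exp (-c₄ * s ^ 4) : ℝ) *
        ((√(Real.pi / (3 * l * c₃ * s)) : ℝ) *
          Complex.exp (-(Real.pi / 4 : ℝ) * Complex.I)) =
        ((Real.exp (-c₄ * s ^ 4) * √(Real.pi / (3 * l * c₃ * s)) : ℝ) : ℂ) *
        Complex.exp ((l * (2 * c₃ * s ^ 3) - Real.pi / 4 : ℝ) * Complex.I) := by
      have h2 : Complex.exp ((l * (2 * c₃ * s ^ 3) - Real.pi / 4 : ℝ) * Complex.I) =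
          oscPhase c₃ l z s * Complex.exp (-(Real.pi / 4 : ℝ) * Complex.I) := by
        rw [oscPhase, ← Complex.exp_add, hzs]
        congr 1
        push_cast
        ring
      rw [h2]
      push_cast
      ring
    rw [h1, Complex.re_ofReal_mul, Complex.exp_ofReal_mul_I_re]
  rw [hval] at hre
  have hsqrt : √(Real.pi / (3 * l * c₃ * s)) = √(Real.pi / (3 * c₃ * s)) / √l := by
    rw [← Real.sqrt_div (by positivity)]
    congr 1
    field_simp
  have hprof : profileAmp c₃ c₄ z * |Real.cos (l * profilePhase c₃ z - Real.pi / 4)| / √l =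
      |2 * (Real.exp (-c₄ * s ^ 4) * √(Real.pi / (3 * l * c₃ * s)) *
        Real.cos (l * (2 * c₃ * s ^ 3) - Real.pi / 4))| := by
    rw [abs_mul, abs_mul, abs_of_pos (two_pos (α := ℝ)),
      abs_of_nonneg (by positivity :
        0 ≤ Real.exp (-c₄ * s ^ 4) * √(Real.pi / (3 * l * c₃ * s))), hsqrt, profileAmp,
      profilePhase, ← hs]
    ring
  rw [oscInt_eq_two_mul_re hc₄, Complex.norm_real, Real.norm_eq_abs, hprof]
  refine (abs_abs_sub_abs_le_abs_sub _ _).trans ?_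
  rw [← mul_sub, abs_mul, abs_of_pos (two_pos)]
  gcongr

theorem statPoint_pos {c₃ z : ℝ} (hc₃ : 0 < c₃) (hz : 0 < z) : 0 < statPoint c₃ z :=
  Real.sqrt_pos.mpr (by positivity)

theorem statPoint_mono {c₃ z w : ℝ} (hc₃ : 0 < c₃) (h : z ≤ w) :
    statPoint c₃ z ≤ statPoint c₃ w := Real.sqrt_le_sqrt (by gcongr)

theorem exists_abs_norm_oscInt_sub_le {c₃ c₄ e M : ℝ} (hc₃ : 0 < c₃) (hc₄ : 0 < c₄)
    (he : 0 < e) : ∃ D : ℝ, 0 ≤ D ∧ ∀ᶠ l : ℝ in atTop, ∀ z ∈ Icc e M,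
      |‖oscInt c₃ c₄ l z‖ -
        profileAmp c₃ c₄ z * |Real.cos (l * profilePhase c₃ z - Real.pi / 4)| / √l| ≤
      D * l ^ (-(3 / 5) : ℝ) := by
  set s₀ := statPoint c₃ e with hs₀
  set s₁ := statPoint c₃ M with hs₁
  have hs₀pos : 0 < s₀ := statPoint_pos hc₃ he
  have hs₁0 : 0 ≤ s₁ := Real.sqrt_nonneg _
  refine ⟨2 * (12 / (3 * c₃ * s₀) + 2 * (c₃ + 4 * c₄ * (s₁ + 1) ^ 3)), by positivity, ?_⟩
  have hlim : Tendsto (fun l : ℝ => l ^ (-(2 / 5) : ℝ)) atTop (𝓝 0) :=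
    tendsto_rpow_neg_atTop (by norm_num)
  filter_upwards [eventually_ge_atTop 1, hlim.eventually_lt_const hs₀pos] with l hl1 hls z hz
  have hl : 0 < l := by linarith
  -- This width balances `1 / (ld)` against `ld⁴`: both equal `l^{-3/5}`, which is smaller than the
  -- main term of order `l^{-1/2}`. The weight error `d²` is smaller still.
  set d := l ^ (-(2 / 5) : ℝ) with hd
  have hdpos : 0 < d := Real.rpow_pos_of_pos hl _
  have hd1 : d ≤ 1 := Real.rpow_le_one_of_one_le_of_nonpos hl1 (by norm_num)
  have hsz0 : s₀ ≤ statPoint c₃ z := statPoint_mono hc₃ hz.1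
  have hsz1 : statPoint c₃ z ≤ s₁ := statPoint_mono hc₃ hz.2
  have hspos := hs₀pos.trans_le hsz0
  refine (abs_norm_oscInt_sub_le hc₃ hc₄ hl (he.trans_le hz.1) hdpos (hls.le.trans hsz0)).trans ?_
  set w := l ^ (-(3 / 5) : ℝ) with hw
  have hwpos : 0 < w := Real.rpow_pos_of_pos hl _
  have h1 : w * (l * d) = 1 := by
    rw [hw, hd, ← Real.rpow_one_add' hl.le (by norm_num), ← Real.rpow_add hl]
    norm_num
  have h2 : l * d ^ 4 = w := by
    rw [hw, hd, ← Real.rpow_natCast, ← Real.rpow_mul hl.le, ← Real.rpow_one_add' hl.le (by norm_num)]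
    norm_num
  have h3 : d ^ 2 ≤ w := by
    rw [hw, hd, ← Real.rpow_natCast, ← Real.rpow_mul hl.le]
    exact Real.rpow_le_rpow_of_exponent_le hl1 (by norm_num)
  have h4 : 12 / (3 * l * c₃ * statPoint c₃ z * d) ≤ 12 / (3 * c₃ * s₀) * w := by
    have h5 : w = 1 / (l * d) := by
      rw [eq_div_iff (by positivity), h1]
    rw [h5, div_mul_div_comm, mul_one,
      show 3 * l * c₃ * statPoint c₃ z * d = 3 * c₃ * statPoint c₃ z * (l * d) by ring]
    gcongr
  have h6 : 2 * d * (l * c₃ * d ^ 3 + 4 * c₄ * (statPoint c₃ z + d) ^ 3 * d) ≤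
      2 * (c₃ + 4 * c₄ * (s₁ + 1) ^ 3) * w := by
    calc _ = 2 * (c₃ * (l * d ^ 4) + 4 * c₄ * (statPoint c₃ z + d) ^ 3 * d ^ 2) := by ring
      _ ≤ 2 * (c₃ * w + 4 * c₄ * (s₁ + 1) ^ 3 * w) := by
        rw [h2]
        gcongr
      _ = _ := by ring
  linarith

/-! ### Riemann sums -/

/-- The dependence on `L` is explicit because the summand used later has a Lipschitz constant
growing with the oscillation. The `3B` pays for the two uncovered end gaps and the last of the `N +
1` terms. -/
theorem abs_riemann_sum_sub_le {h : ℝ → ℝ} {e M L B η y : ℝ} {N : ℕ} (hη : 0 < η)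
    (hL : ∀ u ∈ Icc e M, ∀ v ∈ Icc e M, |h u - h v| ≤ L * |u - v|)
    (hB : ∀ u ∈ Icc e M, |h u| ≤ B) (hL0 : 0 ≤ L)
    (hyM : y ≤ M) (hyM' : M ≤ y + η) (hye : e ≤ y - N * η) (hye' : y - N * η ≤ e + η) :
    |η * ∑ k ∈ Finset.range (N + 1), h (y - k * η) - ∫ u in e..M, h u| ≤
      η * ((M - e) * L + 3 * B) := by
  have hNη : 0 ≤ N * η := by positivity
  have hcont : ContinuousOn h (Icc e M) := by
    refine (LipschitzOnWith.of_dist_le_mul (K := ⟨L, hL0⟩) fun u hu v hv => ?_).continuousOn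
    rw [Real.dist_eq, Real.dist_eq]
    exact hL u hu v hv
  have hint : ∀ u ∈ Icc e M, ∀ v ∈ Icc e M, IntervalIntegrable h volume u v := fun u hu v hv =>
    (hcont.mono (uIcc_subset_Icc hu hv)).intervalIntegrable
  set a : ℕ → ℝ := fun k => y - k * η with ha
  have hmem : ∀ k ≤ N, a k ∈ Icc e M := fun k hk => by
    have h1 : (k : ℝ) * η ≤ N * η := by gcongr
    have h2 : 0 ≤ (k : ℝ) * η := by positivity
    exact ⟨by simp only [ha]; linarith, by simp only [ha]; linarith⟩
  have hsum := intervalIntegral.sum_integral_adjacent_intervals (f := h) (μ := volume) (a := a)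
    (n := N) fun k hk => hint _ (hmem k hk.le) _ (hmem (k + 1) hk)
  have hstep : ∀ k ∈ Finset.range N, |η * h (a k) + ∫ u in a k..a (k + 1), h u| ≤
      L * η * η := by
    intro k hk
    have hk' := Finset.mem_range.mp hk
    have hak : a k - a (k + 1) = η := by simp only [ha]; push_cast; ring
    have hle : a (k + 1) ≤ a k := by linarith
    have h1 : η * h (a k) + ∫ u in a k..a (k + 1), h u =
        ∫ u in a (k + 1)..a k, (h (a k) - h u) := by
      rw [intervalIntegral.integral_sub intervalIntegrable_const
        (hint _ (hmem (k + 1) hk') _ (hmem k hk'.le)), intervalIntegral.integral_const, hak,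
        intervalIntegral.integral_symm (a (k + 1)), smul_eq_mul]
      ring
    rw [h1, ← Real.norm_eq_abs]
    refine (intervalIntegral.norm_integral_le_of_norm_le_const (C := L * η) fun u hu => ?_).trans
      (le_of_eq ?_)
    · rw [uIoc_of_le hle] at hu
      have hu' : u ∈ Icc e M :=
        ⟨(hmem (k + 1) hk').1.trans hu.1.le, hu.2.trans (hmem k hk'.le).2⟩
      rw [Real.norm_eq_abs]
      refine (hL _ (hmem k hk'.le) u hu').trans ?_
      gcongr
      rw [abs_of_nonneg (by linarith [hu.2])]
      linarith [hu.1]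
    · rw [hak, abs_of_pos hη]
  have hsteps : |η * ∑ k ∈ Finset.range N, h (a k) + ∫ u in a 0..a N, h u| ≤
      η * ((M - e) * L) := by
    rw [← hsum, Finset.mul_sum, ← Finset.sum_add_distrib]
    refine (Finset.abs_sum_le_sum_abs _ _).trans ((Finset.sum_le_sum hstep).trans ?_)
    rw [Finset.sum_const, Finset.card_range, nsmul_eq_mul]
    calc (N : ℝ) * (L * η * η) = η * ((N * η) * L) := by ring
      _ ≤ η * ((M - e) * L) := by
        gcongr
        linarith
  have h0N : a 0 = y := by simp [ha]
  have heM : e ≤ M := by linarith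
  have he : e ∈ Icc e M := left_mem_Icc.mpr heM
  have hM : M ∈ Icc e M := right_mem_Icc.mpr heM
  have hB0 : 0 ≤ B := (abs_nonneg _).trans (hB e he)
  have hpiece : ∀ u ∈ Icc e M, ∀ v ∈ Icc e M, |u - v| ≤ η → |∫ t in v..u, h t| ≤ η * B := by
    intro u hu v hv huv
    rw [← Real.norm_eq_abs]
    refine (intervalIntegral.norm_integral_le_of_norm_le_const (C := B) fun t ht =>
      hB t (uIcc_subset_Icc hv hu (uIoc_subset_uIcc ht))).trans ?_
    rw [mul_comm]
    gcongr
  have hN := hmem N le_rfl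
  have h0 := hmem 0 (Nat.zero_le N)
  have hp1 := hpiece (a N) hN e he (by
    rw [abs_of_nonneg (by linarith [hN.1])]
    simp only [ha]
    linarith)
  have hp2 := hpiece M hM (a 0) h0 (by
    rw [abs_of_nonneg (by linarith [h0.2]), h0N]
    linarith)
  have hp3 : |η * h (a N)| ≤ η * B := by
    rw [abs_mul, abs_of_pos hη]
    gcongr
    exact hB _ hN
  have hdec : ∫ u in e..M, h u =
      (∫ u in e..a N, h u) + -(∫ u in a 0..a N, h u) + ∫ u in a 0..M, h u := by
    rw [← intervalIntegral.integral_symm, intervalIntegral.integral_add_adjacent_intervals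
      (hint _ he _ hN) (hint _ hN _ h0), intervalIntegral.integral_add_adjacent_intervals
      (hint _ he _ h0) (hint _ h0 _ hM)]
  rw [Finset.sum_range_succ, hdec]
  rw [abs_le] at hsteps hp1 hp2 hp3 ⊢
  constructor <;> linarith [hsteps.1, hsteps.2, hp1.1, hp1.2, hp2.1, hp2.2, hp3.1, hp3.2]

theorem exists_finset_riemann_sum {e M η : ℝ} (hη : 0 < η) (hηM : η ≤ M - e) (x : ℝ) :
    ∃ J : Finset ℤ, (∀ j : ℤ, j ∈ J ↔ (x - j) * η ∈ Icc e M) ∧ η * J.card ≤ M - e + η ∧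
      ∀ (h : ℝ → ℝ) (L B : ℝ), 0 ≤ L →
        (∀ u ∈ Icc e M, ∀ v ∈ Icc e M, |h u - h v| ≤ L * |u - v|) →
        (∀ u ∈ Icc e M, |h u| ≤ B) →
        |η * ∑ j ∈ J, h ((x - j) * η) - ∫ u in e..M, h u| ≤ η * ((M - e) * L + 3 * B) := by
  -- The map `j ↦ (x - j)η` is decreasing, so the smallest admissible index corresponds to the
  -- endpoint `M`.
  set p : ℤ := ⌈x - M / η⌉ with hp
  set q : ℤ := ⌊x - e / η⌋ with hq
  have hp1 : x - M / η ≤ p := Int.le_ceil _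
  have hp2 : (p : ℝ) < x - M / η + 1 := Int.ceil_lt_add_one _
  have hq1 : (q : ℝ) ≤ x - e / η := Int.floor_le _
  have hq2 : x - e / η < q + 1 := Int.lt_floor_add_one _
  have hM : M / η * η = M := div_mul_cancel₀ _ hη.ne'
  have he : e / η * η = e := div_mul_cancel₀ _ hη.ne'
  have hpq : p ≤ q := by
    have h1 : 1 ≤ (M - e) / η := (one_le_div hη).mpr hηM
    rw [sub_div] at h1
    have h2 : (p : ℝ) < q + 1 := by linarith
    exact Int.lt_add_one_iff.mp (by exact_mod_cast h2)
  obtain ⟨N, hN⟩ := Int.le.dest hpq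
  have hqN : (q : ℝ) = p + N := by exact_mod_cast hN.symm
  have hy1 : (x - p) * η ≤ M := by nlinarith
  have hy2 : M ≤ (x - p) * η + η := by nlinarith
  have hy3 : e ≤ (x - p) * η - N * η := by
    have : (x - p) * η - N * η = (x - q) * η := by rw [hqN]; ring
    rw [this]
    nlinarith
  have hy4 : (x - p) * η - N * η ≤ e + η := by
    have : (x - p) * η - N * η = (x - q) * η := by rw [hqN]; ring
    rw [this]
    nlinarith
  have hinj : Function.Injective fun k : ℕ => p + (k : ℤ) := fun k k' hk => by
    simpa using hk
  refine ⟨(Finset.range (N + 1)).map ⟨_, hinj⟩, fun j => ?_, ?_, fun h L B hL0 hL hB => ?_⟩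
  · simp only [Finset.mem_map, Finset.mem_range, Function.Embedding.coeFn_mk]
    constructor
    · rintro ⟨k, hk, rfl⟩
      have hkN : (k : ℝ) * η ≤ N * η := by
        have : (k : ℝ) ≤ N := by exact_mod_cast Nat.lt_succ_iff.mp hk
        gcongr
      have hk0 : 0 ≤ (k : ℝ) * η := by positivity
      push_cast
      constructor <;> nlinarith
    · rintro ⟨h1, h2⟩
      have h3 : x - M / η ≤ j := by
        rw [← hM] at h2
        linarith [le_of_mul_le_mul_right h2 hη]
      have h4 : (j : ℝ) ≤ x - e / η := by
        rw [← he] at h1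
        linarith [le_of_mul_le_mul_right h1 hη]
      have h5 : p ≤ j := Int.ceil_le.mpr h3
      have h6 : j ≤ q := Int.le_floor.mpr h4
      exact ⟨(j - p).toNat, by omega, by omega⟩
  · rw [Finset.card_map, Finset.card_range]
    push_cast
    nlinarith
  · rw [Finset.sum_map]
    have := abs_riemann_sum_sub_le hη hL hB hL0 hy1 hy2 hy3 hy4
    convert! this using 6 with k hk
    simp only [Function.Embedding.coeFn_mk]
    push_cast
    ring

/-! ### Averaging of a rapidly oscillating factor -/

theorem integral_abs_cos : ∫ t in (0 : ℝ)..Real.pi, |Real.cos t| = 2 := by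
  have hper : Function.Periodic (fun t : ℝ => |Real.cos t|) Real.pi := fun t => by
    simp [Real.cos_add_pi]
  have h := hper.intervalIntegral_add_eq 0 (-(Real.pi / 2))
  rw [zero_add] at h
  rw [h, show -(Real.pi / 2) + Real.pi = Real.pi / 2 by ring]
  have h2 : ∫ t in (-(Real.pi / 2))..(Real.pi / 2), |Real.cos t| =
      ∫ t in (-(Real.pi / 2))..(Real.pi / 2), Real.cos t := by
    refine intervalIntegral.integral_congr fun t ht => ?_
    rw [uIcc_of_le (by linarith [Real.pi_pos])] at ht
    exact abs_of_nonneg (Real.cos_nonneg_of_mem_Icc ht)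
  rw [h2, integral_cos, Real.sin_neg, Real.sin_pi_div_two]
  norm_num

/-- Subtracting its mean `2/π` leaves a function of zero integral over a period, whose primitive is
therefore periodic, hence bounded. -/
theorem exists_bounded_antideriv_abs_cos : ∃ (Φ : ℝ → ℝ) (K : ℝ), 0 ≤ K ∧
    (∀ t, HasDerivAt Φ (|Real.cos t| - 2 / Real.pi) t) ∧ ∀ t, |Φ t| ≤ K := by
  set g : ℝ → ℝ := fun t => |Real.cos t| - 2 / Real.pi with hg
  have hgc : Continuous g := by fun_prop
  have hper : Function.Periodic g Real.pi := fun t => by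
    simp [hg, Real.cos_add_pi]
  have hg0 : ∫ t in (0 : ℝ)..Real.pi, g t = 0 := by
    rw [hg, intervalIntegral.integral_sub (Continuous.intervalIntegrable (by fun_prop) _ _)
      intervalIntegrable_const, integral_abs_cos, intervalIntegral.integral_const]
    have := Real.pi_pos.ne'
    simp only [sub_zero, smul_eq_mul]
    field_simp
    ring
  set Φ : ℝ → ℝ := fun x => ∫ t in (0 : ℝ)..x, g t with hΦ
  have hd : ∀ t, HasDerivAt Φ (g t) t := fun t =>
    hgc.integral_hasStrictDerivAt 0 t |>.hasDerivAt
  have hΦc : Continuous Φ := continuous_iff_continuousAt.mpr fun t => (hd t).continuousAt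
  have hΦper : Function.Periodic Φ Real.pi := fun t => by
    have h1 := hper.intervalIntegral_add_eq 0 t
    rw [zero_add, hg0] at h1
    simp only [hΦ]
    rw [← intervalIntegral.integral_add_adjacent_intervals (hgc.intervalIntegrable 0 t)
      (hgc.intervalIntegrable t (t + Real.pi)), ← h1, add_zero]
  obtain ⟨K, hK⟩ := (hΦper.isBounded_of_continuous Real.pi_pos.ne' hΦc).exists_norm_le
  exact ⟨Φ, K, (norm_nonneg _).trans (hK _ (mem_range_self 0)), hd,
    fun t => hK _ (mem_range_self t)⟩

/-- The factor `ψ'` in the integrand is what makes `(|cos(lψ - φ)| - 2/π) ψ'` the derivative of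
`Φ(lψ - φ) / l`, with `Φ` bounded. One integration by parts then gains `1/l`. -/
theorem exists_abs_integral_mul_abs_cos_sub_le {Q Q' ψ ψ' : ℝ → ℝ} {e M : ℝ} (heM : e ≤ M)
    (hQ : ∀ t ∈ Icc e M, HasDerivAt Q (Q' t) t) (hQ'c : ContinuousOn Q' (Icc e M))
    (hψ : ∀ t ∈ Icc e M, HasDerivAt ψ (ψ' t) t) (hψ'c : ContinuousOn ψ' (Icc e M)) (φ : ℝ) :
    ∃ D, 0 ≤ D ∧ ∀ l : ℝ, 0 < l →
      |(∫ t in e..M, Q t * ψ' t * |Real.cos (l * ψ t - φ)|) -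
        2 / Real.pi * ∫ t in e..M, Q t * ψ' t| ≤ D / l := by
  obtain ⟨Φ, K, hK0, hΦ, hΦK⟩ := exists_bounded_antideriv_abs_cos
  obtain ⟨D, hD⟩ := isCompact_Icc.exists_bound_of_continuousOn hQ'c
  have hD0 : 0 ≤ D := (norm_nonneg _).trans (hD e (left_mem_Icc.mpr heM))
  refine ⟨K * (|Q M| + |Q e| + D * (M - e)), by
    have : 0 ≤ M - e := by linarith
    positivity, fun l hl => ?_⟩
  have hQc : ContinuousOn Q (Icc e M) := fun t ht => (hQ t ht).continuousAt.continuousWithinAt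
  have hψc : ContinuousOn ψ (Icc e M) := fun t ht => (hψ t ht).continuousAt.continuousWithinAt
  set V : ℝ → ℝ := fun t => Φ (l * ψ t - φ) / l with hV
  set V' : ℝ → ℝ := fun t => (|Real.cos (l * ψ t - φ)| - 2 / Real.pi) * (l * ψ' t) / l with hV'
  have hVd : ∀ t ∈ Icc e M, HasDerivAt V (V' t) t := fun t ht =>
    (HasDerivAt.comp t (hΦ _) (((hψ t ht).const_mul l).sub_const φ)).div_const l
  have hV'c : ContinuousOn V' (Icc e M) := by fun_prop
  have hVK : ∀ t, |V t| ≤ K / l := fun t => by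
    rw [hV, abs_div, abs_of_pos hl]
    gcongr
    exact hΦK _
  have hparts := intervalIntegral.integral_mul_deriv_eq_deriv_mul (u := Q) (u' := Q') (v := V)
    (v' := V') (a := e) (b := M) (by rwa [uIcc_of_le heM]) (by rwa [uIcc_of_le heM])
    (by rw [← uIcc_of_le heM] at hQ'c; exact hQ'c.intervalIntegrable)
    (by rw [← uIcc_of_le heM] at hV'c; exact hV'c.intervalIntegrable)
  have hrew : (∫ t in e..M, Q t * ψ' t * |Real.cos (l * ψ t - φ)|) -
        2 / Real.pi * ∫ t in e..M, Q t * ψ' t = ∫ t in e..M, Q t * V' t := by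
    rw [← intervalIntegral.integral_const_mul, ← intervalIntegral.integral_sub]
    · refine intervalIntegral.integral_congr fun t _ => ?_
      simp only [hV']
      field_simp
    · refine ContinuousOn.intervalIntegrable ?_
      rw [uIcc_of_le heM]
      fun_prop
    · refine ContinuousOn.intervalIntegrable ?_
      rw [uIcc_of_le heM]
      fun_prop
  have hI : |∫ t in e..M, Q' t * V t| ≤ D * (K / l) * (M - e) := by
    have := intervalIntegral.norm_integral_le_of_norm_le_const (a := e) (b := M)
      (f := fun t => Q' t * V t) (C := D * (K / l)) fun t ht => by
        rw [uIoc_of_le heM] at ht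
        rw [norm_mul]
        exact mul_le_mul (hD t (Ioc_subset_Icc_self ht)) (hVK t) (norm_nonneg _) hD0
    rwa [abs_of_nonneg (by linarith : 0 ≤ M - e)] at this
  rw [hrew, hparts]
  have h1 : |Q M * V M| ≤ |Q M| * (K / l) := by
    rw [abs_mul]
    gcongr
    exact hVK M
  have h2 : |Q e * V e| ≤ |Q e| * (K / l) := by
    rw [abs_mul]
    gcongr
    exact hVK e
  calc |Q M * V M - Q e * V e - ∫ t in e..M, Q' t * V t|
      ≤ |Q M * V M| + |Q e * V e| + |∫ t in e..M, Q' t * V t| :=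
        (abs_sub _ _).trans (add_le_add_left (abs_sub _ _) _)
    _ ≤ |Q M| * (K / l) + |Q e| * (K / l) + D * (K / l) * (M - e) := by linarith
    _ = _ := by ring

/-! ### The asymptotic profile -/

theorem hasDerivAt_statPoint {c₃ z : ℝ} (hc₃ : 0 < c₃) (hz : 0 < z) :
    HasDerivAt (statPoint c₃) (1 / (6 * c₃ * statPoint c₃ z)) z := by
  have h := ((hasDerivAt_id z).div_const (3 * c₃)).sqrt (by
    simp only [id]
    positivity)
  have hs := (statPoint_pos hc₃ hz).ne'
  convert! h using 1
  simp only [id]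
  change _ = 1 / (3 * c₃) / (2 * statPoint c₃ z)
  field_simp
  norm_num

/-- Envelope principle: minus the critical value of `c₃t³ - zt` has derivative `s` in `z`. It never
vanishes for `z > 0`, so the amplitude can be divided by it for the averaging argument. -/
theorem hasDerivAt_profilePhase {c₃ z : ℝ} (hc₃ : 0 < c₃) (hz : 0 < z) :
    HasDerivAt (profilePhase c₃) (statPoint c₃ z) z := by
  have h := ((hasDerivAt_statPoint hc₃ hz).fun_pow 3).const_mul (2 * c₃)
  have hs := (statPoint_pos hc₃ hz).ne'
  convert! h using 1
  field_simp
  norm_num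
  ring

theorem contDiffOn_statPoint {c₃ : ℝ} (hc₃ : 0 < c₃) : ContDiffOn ℝ 1 (statPoint c₃) (Ioi 0) := by
  unfold statPoint
  refine ContDiffOn.sqrt (by fun_prop) fun z hz => ?_
  have : 0 < z := hz
  positivity

theorem contDiffOn_profileAmp {c₃ c₄ : ℝ} (hc₃ : 0 < c₃) :
    ContDiffOn ℝ 1 (profileAmp c₃ c₄) (Ioi 0) := by
  have hs := contDiffOn_statPoint hc₃
  have hpos : ∀ z ∈ Ioi (0 : ℝ), 3 * c₃ * statPoint c₃ z ≠ 0 := fun z hz => by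
    have := statPoint_pos hc₃ hz
    positivity
  unfold profileAmp
  refine ContDiffOn.mul (contDiffOn_const.mul ((contDiffOn_const.mul (hs.pow 4)).exp)) ?_
  refine ContDiffOn.sqrt (contDiffOn_const.div (contDiffOn_const.mul hs) hpos) fun z hz => ?_
  exact div_ne_zero Real.pi_pos.ne' (hpos z hz)

theorem exists_lipschitz_of_contDiffOn_Ioi {f : ℝ → ℝ} (hf : ContDiffOn ℝ 1 f (Ioi 0)) {e : ℝ}
    (he : 0 < e) (M : ℝ) :
    ∃ L, 0 ≤ L ∧ ∀ u ∈ Icc e M, ∀ v ∈ Icc e M, |f u - f v| ≤ L * |u - v| := by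
  have hsub : Icc e M ⊆ Ioi 0 := fun t ht => he.trans_le ht.1
  have hc : ContinuousOn (deriv f) (Icc e M) :=
    (hf.continuousOn_deriv_of_isOpen isOpen_Ioi le_rfl).mono hsub
  obtain ⟨L, hL⟩ := isCompact_Icc.exists_bound_of_continuousOn hc
  refine ⟨max L 0, le_max_right _ _, fun u hu v hv => ?_⟩
  have := Convex.norm_image_sub_le_of_norm_deriv_le (𝕜 := ℝ) (f := f) (C := max L 0)
    (fun t ht => (hf.differentiableOn one_ne_zero).differentiableAt (isOpen_Ioi.mem_nhds (hsub ht)))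
    (fun t ht => (hL t ht).trans (le_max_left _ _)) (convex_Icc e M) hv hu
  simpa [Real.norm_eq_abs] using this

theorem exists_abs_integral_profile_sub_le {c₃ : ℝ} (hc₃ : 0 < c₃) (c₄ : ℝ) {e M : ℝ} (he : 0 < e)
    (heM : e ≤ M) :
    ∃ D, 0 ≤ D ∧ ∀ l : ℝ, 0 < l →
      |(∫ z in e..M, profileAmp c₃ c₄ z * |Real.cos (l * profilePhase c₃ z - Real.pi / 4)|) -
        2 / Real.pi * ∫ z in e..M, profileAmp c₃ c₄ z| ≤ D / l := by
  have hsub : Icc e M ⊆ Ioi 0 := fun t ht => he.trans_le ht.1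
  have hpos : ∀ z ∈ Ioi (0 : ℝ), statPoint c₃ z ≠ 0 := fun z hz => (statPoint_pos hc₃ hz).ne'
  set Q : ℝ → ℝ := fun z => profileAmp c₃ c₄ z / statPoint c₃ z with hQ
  have hQc : ContDiffOn ℝ 1 Q (Ioi 0) :=
    (contDiffOn_profileAmp hc₃).div (contDiffOn_statPoint hc₃) hpos
  obtain ⟨D, hD0, hD⟩ := exists_abs_integral_mul_abs_cos_sub_le (Q := Q) (Q' := deriv Q)
    (ψ := profilePhase c₃) (ψ' := statPoint c₃) heM
    (fun t ht => ((hQc.differentiableOn one_ne_zero).differentiableAt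
      (isOpen_Ioi.mem_nhds (hsub ht))).hasDerivAt)
    ((hQc.continuousOn_deriv_of_isOpen isOpen_Ioi le_rfl).mono hsub)
    (fun t ht => hasDerivAt_profilePhase hc₃ (hsub ht))
    ((contDiffOn_statPoint hc₃).continuousOn.mono hsub) (Real.pi / 4)
  refine ⟨D, hD0, fun l hl => ?_⟩
  have h1 := hD l hl
  have hQe : ∀ z ∈ uIcc e M, Q z * statPoint c₃ z = profileAmp c₃ c₄ z := fun z hz => by
    rw [uIcc_of_le heM] at hz
    exact div_mul_cancel₀ _ (hpos z (hsub hz))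
  rwa [intervalIntegral.integral_congr hQe, intervalIntegral.integral_congr (fun z hz => by
    rw [hQe z hz])] at h1

/-- The summand has Lipschitz constant `O(l)` and the grid has step `l⁻²`, so the Riemann sum error
is `O(1/l)`, the same order as the averaging error. -/
theorem exists_sum_profile_sub_le {c₃ : ℝ} (hc₃ : 0 < c₃) (c₄ : ℝ) {e M : ℝ} (he : 0 < e)
    (heM : e < M) :
    ∃ D, 0 ≤ D ∧ ∀ᶠ l : ℝ in atTop, ∀ x : ℝ, ∃ J : Finset ℤ,
      (∀ j : ℤ, j ∈ J ↔ (x - j) / l ^ 2 ∈ Icc e M) ∧ J.card / l ^ 2 ≤ M - e + 1 ∧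
      |(∑ j ∈ J, profileAmp c₃ c₄ ((x - j) / l ^ 2) *
        |Real.cos (l * profilePhase c₃ ((x - j) / l ^ 2) - Real.pi / 4)|) / l ^ 2 -
        2 / Real.pi * ∫ z in e..M, profileAmp c₃ c₄ z| ≤ D / l := by
  have hsub : Icc e M ⊆ Ioi 0 := fun t ht => he.trans_le ht.1
  obtain ⟨D₁, hD₁0, hD₁⟩ := exists_abs_integral_profile_sub_le hc₃ c₄ he heM.le
  obtain ⟨L₁, hL₁0, hL₁⟩ := exists_lipschitz_of_contDiffOn_Ioi
    (contDiffOn_profileAmp (c₄ := c₄) hc₃) he M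
  have hphase : ContDiffOn ℝ 1 (profilePhase c₃) (Ioi 0) :=
    contDiffOn_const.mul ((contDiffOn_statPoint hc₃).pow 3)
  obtain ⟨L₂, hL₂0, hL₂⟩ := exists_lipschitz_of_contDiffOn_Ioi hphase he M
  obtain ⟨B, hB⟩ := isCompact_Icc.exists_bound_of_continuousOn
    ((contDiffOn_profileAmp (c₄ := c₄) hc₃).continuousOn.mono hsub)
  have hB0 : 0 ≤ B := (norm_nonneg _).trans (hB e (left_mem_Icc.mpr heM.le))
  have hMe : 0 < M - e := by linarith
  refine ⟨(M - e) * (L₁ + B * L₂) + 3 * B + D₁, by positivity, ?_⟩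
  filter_upwards [eventually_ge_atTop (max 1 (1 / (M - e)))] with l hl x
  have hl1 : 1 ≤ l := (le_max_left _ _).trans hl
  have hl2 : 1 / (M - e) ≤ l := (le_max_right _ _).trans hl
  have hl0 : 0 < l := by linarith
  have hη : 0 < (l ^ 2)⁻¹ := by positivity
  have hη1 : (l ^ 2)⁻¹ ≤ l⁻¹ := by
    gcongr
    nlinarith
  have hη2 : (l ^ 2)⁻¹ ≤ M - e := hη1.trans (by
    rw [inv_le_comm₀ hl0 hMe, ← one_div]
    exact hl2)
  have hη3 : (l ^ 2)⁻¹ ≤ 1 := inv_le_one_of_one_le₀ (by nlinarith)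
  obtain ⟨J, hJ, hcard, hsum⟩ := exists_finset_riemann_sum hη hη2 x
  refine ⟨J, fun j => by rw [hJ, div_eq_mul_inv], ?_, ?_⟩
  · rw [div_eq_inv_mul]
    linarith
  · set h : ℝ → ℝ := fun z =>
      profileAmp c₃ c₄ z * |Real.cos (l * profilePhase c₃ z - Real.pi / 4)| with hh
    have hcosLip : ∀ u v : ℝ, |(|Real.cos u| - |Real.cos v|)| ≤ |u - v| := fun u v =>
      (abs_abs_sub_abs_le_abs_sub _ _).trans (by
        have := Real.abs_cos_sub_cos_le u v
        exact this)
    have hLip : ∀ u ∈ Icc e M, ∀ v ∈ Icc e M, |h u - h v| ≤ (L₁ + B * (l * L₂)) * |u - v| := by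
      intro u hu v hv
      have h1 := hcosLip (l * profilePhase c₃ u - Real.pi / 4) (l * profilePhase c₃ v - Real.pi / 4)
      rw [sub_sub_sub_cancel_right, ← mul_sub, abs_mul, abs_of_pos hl0] at h1
      have h2 : h u - h v = (profileAmp c₃ c₄ u - profileAmp c₃ c₄ v) *
          |Real.cos (l * profilePhase c₃ u - Real.pi / 4)| +
          profileAmp c₃ c₄ v * (|Real.cos (l * profilePhase c₃ u - Real.pi / 4)| -
            |Real.cos (l * profilePhase c₃ v - Real.pi / 4)|) := by
        simp only [hh]
        ring
      rw [h2]
      refine (abs_add_le _ _).trans ?_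
      rw [abs_mul, abs_mul, abs_abs, add_mul]
      refine add_le_add ?_ ?_
      · exact (mul_le_of_le_one_right (abs_nonneg _) (Real.abs_cos_le_one _)).trans (hL₁ u hu v hv)
      · calc _ ≤ B * (l * |profilePhase c₃ u - profilePhase c₃ v|) := by
              gcongr
              exact hB v hv
          _ ≤ B * (l * (L₂ * |u - v|)) := by
              gcongr
              exact hL₂ u hu v hv
          _ = _ := by ring
    have hbd : ∀ u ∈ Icc e M, |h u| ≤ B := fun u hu => by
      rw [hh, abs_mul, abs_abs]
      exact (mul_le_of_le_one_right (abs_nonneg _) (Real.abs_cos_le_one _)).trans (hB u hu)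
    have h3 := hsum h _ B (by positivity) hLip hbd
    have h4 := hD₁ l hl0
    have h5 : (l ^ 2)⁻¹ * ((M - e) * (L₁ + B * (l * L₂)) + 3 * B) ≤
        ((M - e) * (L₁ + B * L₂) + 3 * B) / l := by
      rw [← div_eq_inv_mul, div_le_div_iff₀ (by positivity) hl0]
      have h6 : (M - e) * (L₁ + B * (l * L₂)) + 3 * B ≤
          ((M - e) * (L₁ + B * L₂) + 3 * B) * l := by
        have h7 : 0 ≤ ((M - e) * L₁ + 3 * B) * (l - 1) :=
          mul_nonneg (by positivity) (by linarith)
        linarith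
      calc _ ≤ ((M - e) * (L₁ + B * L₂) + 3 * B) * l * l := by gcongr
        _ = _ := by ring
    have h8 : (∑ j ∈ J, h ((x - j) / l ^ 2)) / l ^ 2 =
        (l ^ 2)⁻¹ * ∑ j ∈ J, h ((x - j) * (l ^ 2)⁻¹) := by
      simp only [div_eq_mul_inv]
      ring
    change |(∑ j ∈ J, h ((x - j) / l ^ 2)) / l ^ 2 - _| ≤ _
    rw [h8, add_div]
    refine (abs_sub_le _ (∫ z in e..M, h z) _).trans ?_
    linarith

theorem profileAmp_eq {c₃ : ℝ} (hc₃ : 0 < c₃) (c₄ : ℝ) {z : ℝ} (hz : 0 < z) :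
    profileAmp c₃ c₄ z = 2 * √(Real.pi / (3 * c₃)) * (3 * c₃) ^ (1 / 4 : ℝ) *
      (z ^ (-(1 / 4) : ℝ) * Real.exp (-(c₄ / (3 * c₃) ^ 2) * z ^ (2 : ℝ))) := by
  have h3 : 0 < 3 * c₃ := by positivity
  have hs : statPoint c₃ z ^ 4 = z ^ 2 / (3 * c₃) ^ 2 := by
    rw [show statPoint c₃ z ^ 4 = (statPoint c₃ z ^ 2) ^ 2 by ring, statPoint,
      Real.sq_sqrt (by positivity), div_pow]
  have hs2 : √(Real.pi / (3 * c₃ * statPoint c₃ z)) =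
      √(Real.pi / (3 * c₃)) * ((3 * c₃) ^ (1 / 4 : ℝ) * z ^ (-(1 / 4) : ℝ)) := by
    rw [← div_div, Real.sqrt_div (by positivity), div_eq_mul_inv]
    congr 1
    rw [statPoint, Real.sqrt_eq_rpow, Real.sqrt_eq_rpow, ← Real.rpow_mul (by positivity),
      Real.div_rpow hz.le h3.le, inv_div, div_eq_mul_inv, Real.rpow_neg hz.le]
    norm_num
  rw [profileAmp, hs, hs2, Real.rpow_two,
    show -c₄ * (z ^ 2 / (3 * c₃) ^ 2) = -(c₄ / (3 * c₃) ^ 2) * z ^ 2 by ring]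
  ring

theorem integrableOn_profileAmp {c₃ c₄ : ℝ} (hc₃ : 0 < c₃) (hc₄ : 0 < c₄) :
    IntegrableOn (profileAmp c₃ c₄) (Ioi 0) := by
  have h := (integrableOn_rpow_mul_exp_neg_mul_rpow (p := 2) (s := -(1 / 4))
    (b := c₄ / (3 * c₃) ^ 2) (by norm_num) (by norm_num) (by positivity)).const_mul
    (2 * √(Real.pi / (3 * c₃)) * (3 * c₃) ^ (1 / 4 : ℝ))
  exact IntegrableOn.congr_fun h (fun z hz => (profileAmp_eq hc₃ c₄ hz).symm) measurableSet_Ioi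

/-- The prefactor `1/π²` is `(2π)⁻¹`, from Fourier inversion, times the mean `2/π` of `|cos|`. The
exponents `-1/4` and `2` lead to `Γ(3/8)`, rewritten through `Γ(11/8) = (3/8) Γ(3/8)`. -/
theorem integral_profileAmp {c₃ c₄ : ℝ} (hc₃ : 0 < c₃) (hc₄ : 0 < c₄) :
    (1 / Real.pi ^ 2) * ∫ z in Ioi 0, profileAmp c₃ c₄ z =
      8 * Real.Gamma (11 / 8) / (√3 * Real.pi ^ (3 / 2 : ℝ)) *
        (c₃ ^ (1 / 2 : ℝ) / c₄ ^ (3 / 8 : ℝ)) := by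
  have h3 : 0 < 3 * c₃ := by positivity
  have hpi := Real.pi_pos
  have hΓ : Real.Gamma (11 / 8) = 3 / 8 * Real.Gamma (3 / 8) := by
    rw [← Real.Gamma_add_one (by norm_num)]
    norm_num
  rw [setIntegral_congr_fun measurableSet_Ioi (fun z hz => profileAmp_eq hc₃ c₄ hz),
    integral_const_mul, integral_rpow_mul_exp_neg_mul_rpow (by norm_num) (by norm_num)
    (by positivity), hΓ, Real.div_rpow hc₄.le (by positivity), ← Real.rpow_natCast (3 * c₃) 2,
    ← Real.rpow_mul h3.le, Real.sqrt_div hpi.le, Real.sqrt_eq_rpow, Real.sqrt_eq_rpow,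
    Real.sqrt_eq_rpow]
  norm_num
  rw [Real.rpow_neg hc₄.le, Real.rpow_neg h3.le]
  have e1 : (3 * c₃) ^ (1 / 4 : ℝ) * (3 * c₃) ^ (3 / 4 : ℝ) =
      (3 * c₃) ^ (1 / 2 : ℝ) * (3 * c₃) ^ (1 / 2 : ℝ) := by
    rw [← Real.rpow_add h3, ← Real.rpow_add h3]
    norm_num
  have e2 : (3 * c₃) ^ (1 / 2 : ℝ) = 3 ^ (1 / 2 : ℝ) * c₃ ^ (1 / 2 : ℝ) :=
    Real.mul_rpow (by norm_num) hc₃.le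
  have e3 : Real.pi ^ (3 / 2 : ℝ) * Real.pi ^ (1 / 2 : ℝ) = Real.pi ^ 2 := by
    rw [← Real.rpow_add hpi, ← Real.rpow_natCast]
    norm_num
  have e4 : (3 : ℝ) ^ (1 / 2 : ℝ) * 3 ^ (1 / 2 : ℝ) = 3 := by
    rw [← Real.rpow_add (by norm_num)]
    norm_num
  have p1 : (3 : ℝ) ^ (1 / 2 : ℝ) ≠ 0 := by positivity
  have p2 : c₃ ^ (1 / 2 : ℝ) ≠ 0 := by positivity
  have p3 : Real.pi ^ (1 / 2 : ℝ) ≠ 0 := by positivity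
  have p4 : Real.pi ^ (3 / 2 : ℝ) ≠ 0 := by positivity
  have p5 : c₄ ^ (3 / 8 : ℝ) ≠ 0 := by positivity
  calc _ = (Real.pi ^ 2)⁻¹ * Real.pi ^ (1 / 2 : ℝ) *
        (((3 * c₃) ^ (1 / 4 : ℝ) * (3 * c₃) ^ (3 / 4 : ℝ)) / (3 * c₃) ^ (1 / 2 : ℝ)) *
        (c₄ ^ (3 / 8 : ℝ))⁻¹ * Real.Gamma (3 / 8) := by
          rw [div_inv_eq_mul]
          ring
    _ = _ := by
      rw [e1, ← e3, e2]
      -- The fractional powers become atoms, since only the relations `e3` and `e4` between them are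
      -- still needed.
      generalize (3 : ℝ) ^ (1 / 2 : ℝ) = w at *
      generalize c₃ ^ (1 / 2 : ℝ) = v at *
      generalize Real.pi ^ (1 / 2 : ℝ) = u at *
      generalize Real.pi ^ (3 / 2 : ℝ) = t at *
      generalize c₄ ^ (3 / 8 : ℝ) = r at *
      field_simp
      linear_combination e4

theorem tendsto_integral_profileAmp {c₃ c₄ : ℝ} (hc₃ : 0 < c₃) (hc₄ : 0 < c₄) :
    Tendsto (fun M : ℝ => ∫ z in M⁻¹..M, profileAmp c₃ c₄ z) atTop
      (𝓝 (∫ z in Ioi 0, profileAmp c₃ c₄ z)) := by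
  have hcov : AECover (volume.restrict (Ioi (0 : ℝ))) atTop fun M : ℝ => Ioc M⁻¹ M := by
    refine ⟨?_, fun _ => measurableSet_Ioc⟩
    filter_upwards [ae_restrict_mem measurableSet_Ioi] with z hz
    filter_upwards [tendsto_inv_atTop_zero.eventually_lt_const hz, eventually_ge_atTop z]
      with M h1 h2 using ⟨h1, h2⟩
  refine (hcov.integral_tendsto_of_countably_generated
    (integrableOn_profileAmp hc₃ hc₄)).congr' ?_
  filter_upwards [eventually_ge_atTop 1] with M hM
  have hM0 : 0 < M := by linarith
  have hle : M⁻¹ ≤ M := (inv_le_one_of_one_le₀ hM).trans hM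
  rw [intervalIntegral.integral_of_le hle, Measure.restrict_restrict measurableSet_Ioc]
  congr 2
  exact inter_eq_left.mpr fun z hz => (inv_pos.mpr hM0).trans hz.1

/-! ### Tails of `∑ 1 / (j - x)²` -/

theorem sum_one_div_sq_le_of_le {T x : ℝ} (hT : 1 ≤ T) (s : Finset ℤ)
    (hs : ∀ j ∈ s, T ≤ (j : ℝ) - x) : ∑ j ∈ s, 1 / ((j : ℝ) - x) ^ 2 ≤ 2 / T := by
  set p : ℤ := ⌈x + T⌉ with hp
  have hp1 : x + T ≤ p := Int.le_ceil _
  have hmem : ∀ j ∈ s, p ≤ j := fun j hj => Int.ceil_le.mpr (by linarith [hs j hj])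
  obtain ⟨N, hN⟩ : ∃ N : ℕ, ∀ j ∈ s, (j - p).toNat < N :=
    ⟨s.sup (fun j => (j - p).toNat) + 1, fun j hj =>
      Nat.lt_succ_of_le (Finset.le_sup (f := fun j : ℤ => (j - p).toNat) hj)⟩
  have hsub : s ⊆ (Finset.range N).image fun k : ℕ => p + (k : ℤ) := fun j hj => by
    rw [Finset.mem_image]
    exact ⟨(j - p).toNat, Finset.mem_range.mpr (hN j hj), by have := hmem j hj; omega⟩
  set u : ℕ → ℝ := fun k => (p : ℝ) - x + k with hu
  have huT : ∀ k, T ≤ u k := fun k => by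
    have : (0 : ℝ) ≤ k := Nat.cast_nonneg k
    simp only [hu]
    linarith
  calc ∑ j ∈ s, 1 / ((j : ℝ) - x) ^ 2
      ≤ ∑ j ∈ (Finset.range N).image fun k : ℕ => p + (k : ℤ), 1 / ((j : ℝ) - x) ^ 2 :=
        Finset.sum_le_sum_of_subset_of_nonneg hsub fun _ _ _ => by positivity
    _ = ∑ k ∈ Finset.range N, 1 / u k ^ 2 := by
        rw [Finset.sum_image fun a _ b _ h => by simpa using h]
        refine Finset.sum_congr rfl fun k _ => ?_
        simp only [hu]
        push_cast
        ring
    -- Telescoping majorant: `1/u² ≤ 2/u - 2/(u+1)` holds exactly because `u ≥ 1`.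
    _ ≤ ∑ k ∈ Finset.range N, (2 / u k - 2 / u (k + 1)) := by
        refine Finset.sum_le_sum fun k _ => ?_
        have h1 : u (k + 1) = u k + 1 := by simp only [hu]; push_cast; ring
        have h2 : 1 ≤ u k := hT.trans (huT k)
        have h3 : 0 < u k := by linarith
        rw [h1, div_sub_div _ _ h3.ne' (by positivity),
          div_le_div_iff₀ (by positivity) (by positivity)]
        nlinarith
    _ = 2 / u 0 - 2 / u N := Finset.sum_range_sub' _ _
    _ ≤ 2 / T := by
        have h1 := huT 0
        have h2 : 0 ≤ 2 / u N := div_nonneg zero_le_two (by linarith [huT N])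
        have h3 : 2 / u 0 ≤ 2 / T := by gcongr
        linarith

theorem sum_one_div_sq_le {T x : ℝ} (hT : 1 ≤ T) (s : Finset ℤ)
    (hs : ∀ j ∈ s, T ≤ |(j : ℝ) - x|) : ∑ j ∈ s, 1 / ((j : ℝ) - x) ^ 2 ≤ 4 / T := by
  have h1 := sum_one_div_sq_le_of_le (x := x) hT (s.filter fun j : ℤ => 0 ≤ (j : ℝ) - x)
    fun j hj => by
      rw [Finset.mem_filter] at hj
      have := hs j hj.1
      rwa [abs_of_nonneg hj.2] at this
  have h2 := sum_one_div_sq_le_of_le (x := -x) hT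
    ((s.filter fun j : ℤ => ¬ 0 ≤ (j : ℝ) - x).image Neg.neg) fun j hj => by
      rw [Finset.mem_image] at hj
      obtain ⟨k, hk, rfl⟩ := hj
      rw [Finset.mem_filter, not_le] at hk
      have := hs k hk.1
      rw [abs_of_neg hk.2] at this
      push_cast
      linarith
  rw [Finset.sum_image fun a _ b _ h => neg_injective h] at h2
  have h3 : ∀ j : ℤ, 1 / (((-j : ℤ) : ℝ) - -x) ^ 2 = 1 / ((j : ℝ) - x) ^ 2 := fun j => by
    congr 1
    push_cast
    ring
  simp only [h3] at h2
  rw [← Finset.sum_filter_add_sum_filter_not s fun j : ℤ => 0 ≤ (j : ℝ) - x]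
  calc _ ≤ 2 / T + 2 / T := add_le_add h1 h2
    _ = 4 / T := by ring

/-! ### Summation of the Green's function -/

theorem sum_le_sqrt_card_mul_sqrt (s : Finset ℤ) (f : ℤ → ℝ) :
    ∑ j ∈ s, f j ≤ √s.card * √(∑ j ∈ s, f j ^ 2) := by
  have := Real.sum_mul_le_sqrt_mul_sqrt s (fun _ => (1 : ℝ)) f
  simpa using this

theorem sum_sq_le_sum_support (b : ℤ →₀ ℂ) (w : ℤ → ℝ) (hw : ∀ j, 0 ≤ w j) (s : Finset ℤ) :
    ∑ j ∈ s, w j * ‖b j‖ ^ 2 ≤ ∑ j ∈ b.support, w j * ‖b j‖ ^ 2 := by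
  rw [Finset.sum_subset (Finset.subset_union_right (s₁ := s) (s₂ := b.support)) fun j _ hj => by
    simp [Finsupp.notMem_support_iff.mp hj]]
  exact Finset.sum_le_sum_of_subset_of_nonneg Finset.subset_union_left
    fun j _ _ => mul_nonneg (hw j) (by positivity)

theorem sum_norm_le_sum_support (b : ℤ →₀ ℂ) (s : Finset ℤ) :
    ∑ j ∈ s, ‖b j‖ ≤ ∑ j ∈ b.support, ‖b j‖ := by
  rw [Finset.sum_subset (Finset.subset_union_right (s₁ := s) (s₂ := b.support)) fun j _ hj => by
    simp [Finsupp.notMem_support_iff.mp hj]]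
  exact Finset.sum_le_sum_of_subset_of_nonneg Finset.subset_union_left
    fun j _ _ => norm_nonneg _

/-- Cauchy–Schwarz away from the centre `x`. -/
theorem sum_norm_far_le {b : ℤ →₀ ℂ} {x T V : ℝ} (hT : 1 ≤ T) (s : Finset ℤ)
    (hs : ∀ j ∈ s, T ≤ |(j : ℝ) - x|)
    (hV : ∑ j ∈ b.support, ((j : ℝ) - x) ^ 2 * ‖b j‖ ^ 2 ≤ V) :
    ∑ j ∈ s, ‖b j‖ ≤ √(4 / T) * √V := by
  have h1 : ∀ j ∈ s, ‖b j‖ = (1 / |(j : ℝ) - x|) * (|(j : ℝ) - x| * ‖b j‖) := fun j hj => by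
    have : 0 < |(j : ℝ) - x| := by linarith [hs j hj]
    field_simp
  rw [Finset.sum_congr rfl h1]
  refine (Real.sum_mul_le_sqrt_mul_sqrt _ _ _).trans ?_
  gcongr
  · refine le_trans (le_of_eq (Finset.sum_congr rfl fun j _ => ?_)) (sum_one_div_sq_le hT s hs)
    rw [div_pow, sq_abs, one_pow]
  · refine le_trans (le_of_eq (Finset.sum_congr rfl fun j _ => ?_))
      ((sum_sq_le_sum_support b (fun j => ((j : ℝ) - x) ^ 2) (fun _ => sq_nonneg _) s).trans hV)
    rw [mul_pow, sq_abs]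

theorem sum_norm_support_le {b : ℤ →₀ ℂ} {z : ℤ → ℝ} {e M : ℝ} {J J₁ J₂ : Finset ℤ}
    (hJ : ∀ j, j ∈ J ↔ z j ∈ Icc e M) (hJ₁ : ∀ j, j ∈ J₁ ↔ z j ∈ Icc (-M) (-e))
    (hJ₂ : ∀ j, j ∈ J₂ ↔ z j ∈ Icc (-e) e) :
    ∑ j ∈ b.support, ‖b j‖ ≤ ∑ j ∈ J, ‖b j‖ + ∑ j ∈ J₁, ‖b j‖ + ∑ j ∈ J₂, ‖b j‖ +
      ∑ j ∈ b.support.filter fun j => M ≤ |z j|, ‖b j‖ := by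
  have hsub : b.support ⊆ J ∪ J₁ ∪ J₂ ∪ b.support.filter fun j => M ≤ |z j| := fun j hj => by
    simp only [Finset.mem_union, Finset.mem_filter, hJ, hJ₁, hJ₂, mem_Icc]
    rcases le_or_gt M |z j| with h | h
    · exact Or.inr ⟨hj, h⟩
    · left
      rw [abs_lt] at h
      rcases le_total e (z j) with h1 | h1
      · exact Or.inl (Or.inl ⟨h1, h.2.le⟩)
      · rcases le_total (z j) (-e) with h2 | h2
        · exact Or.inl (Or.inr ⟨h.1.le, h2⟩)
        · exact Or.inr ⟨h2, h1⟩
  have hunion : ∀ s t : Finset ℤ, ∑ j ∈ s ∪ t, ‖b j‖ ≤ ∑ j ∈ s, ‖b j‖ + ∑ j ∈ t, ‖b j‖ := by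
    intro s t
    rw [← Finset.sum_union_inter]
    exact le_add_of_nonneg_right (Finset.sum_nonneg fun _ _ => norm_nonneg _)
  refine (Finset.sum_le_sum_of_subset_of_nonneg hsub fun _ _ _ => norm_nonneg _).trans ?_
  have h1 := hunion (J ∪ J₁ ∪ J₂) (b.support.filter fun j => M ≤ |z j|)
  have h2 := hunion (J ∪ J₁) J₂
  have h3 := hunion J J₁
  linarith

/-- The estimates on a convolution power at scale `l = n^{1/4}`, centred at `x = αn`, from which
the asymptotics of the `ℓ¹` norm follow. -/
structure ScaleBounds (c₃ c₄ D : ℝ) (b : ℤ →₀ ℂ) (l x : ℝ) : Prop where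
  sum_sq : ∑ j ∈ b.support, ‖b j‖ ^ 2 ≤ D / l
  sum_weighted : ∑ j ∈ b.support, ((j : ℝ) - x) ^ 2 * ‖b j‖ ^ 2 ≤ D * l ^ 3
  approx : ∀ j : ℤ,
    ‖b j - (2 * Real.pi * l : ℂ)⁻¹ * oscInt c₃ c₄ l ((x - j) / l ^ 2)‖ ≤ D / l ^ 2

/-- The restriction `2 ≤ n` keeps at least one factor of the symbol after one has been removed by
differentiation or telescoping. -/
theorem DispersiveAssumption.exists_scaleBounds {a : ℤ →₀ ℂ} {α c₃ c₄ : ℝ}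
    (ha : DispersiveAssumption a α c₃ c₄) : ∃ D, 0 ≤ D ∧ ∀ (n : ℕ) (l : ℝ), 2 ≤ n → 0 < l →
      l ^ 4 = n → ScaleBounds c₃ c₄ D (convPow a n) l (α * n) := by
  obtain ⟨c, C, hc, hcc₄, hC, hb⟩ := ha.symbol_bounds
  have hpi := Real.pi_pos
  set D₁ := (2 * Real.pi)⁻¹ * quarticMoment c 0
  set D₂ := (2 * Real.pi)⁻¹ * (C ^ 2 * quarticMoment (c / 2) 4)
  set D₃ := (2 * Real.pi)⁻¹ * ((C + 1) * quarticMoment (c / 2) 5)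
  have h1 : D₁ ≤ max D₁ (max D₂ D₃) := le_max_left _ _
  have h2 : D₂ ≤ max D₁ (max D₂ D₃) := (le_max_left _ _).trans (le_max_right _ _)
  have h3 : D₃ ≤ max D₁ (max D₂ D₃) := (le_max_right _ _).trans (le_max_right _ _)
  refine ⟨max D₁ (max D₂ D₃), le_trans ?_ h1, fun n l hn hl0 hl => ⟨?_, ?_, fun j => ?_⟩⟩
  · exact mul_nonneg (by positivity) (quarticMoment_nonneg _ _)
  · exact (sum_norm_sq_convPow_le hc (fun θ hθ => (hb θ hθ).1) hl0 hl).trans (by gcongr)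
  · exact (sum_weighted_norm_sq_convPow_le hc (fun θ hθ => (hb θ hθ).1)
      (fun θ hθ => (hb θ hθ).2.2) hn hl0 hl).trans (by gcongr)
  · exact (norm_convPow_sub_oscInt_le hc hcc₄ hC (fun θ hθ => (hb θ hθ).1)
      (fun θ hθ => (hb θ hθ).2.1) hn hl0 hl j).trans (by gcongr)

/-- The contribution of the oscillating region. -/
theorem exists_sum_middle_sub_le {c₃ c₄ D : ℝ} (hc₃ : 0 < c₃) (hc₄ : 0 < c₄) (hD : 0 ≤ D)
    {e M : ℝ} (he : 0 < e) (heM : e < M) :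
    ∃ K, 0 ≤ K ∧ ∀ᶠ l : ℝ in atTop, ∀ (b : ℤ →₀ ℂ) (x : ℝ), ScaleBounds c₃ c₄ D b l x →
      ∃ J : Finset ℤ, (∀ j : ℤ, j ∈ J ↔ (x - j) / l ^ 2 ∈ Icc e M) ∧
      |(∑ j ∈ J, ‖b j‖) / √l - 1 / Real.pi ^ 2 * ∫ z in e..M, profileAmp c₃ c₄ z| ≤
        K * l ^ (-(1 / 10) : ℝ) := by
  obtain ⟨D₁, hD₁0, hD₁⟩ := exists_abs_norm_oscInt_sub_le (M := M) hc₃ hc₄ he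
  obtain ⟨D₂, hD₂0, hD₂⟩ := exists_sum_profile_sub_le hc₃ c₄ he heM
  have hpi := Real.pi_pos
  have hMe : 0 < M - e := by linarith
  refine ⟨(M - e + 1) * (D + D₁) + D₂, by positivity, ?_⟩
  filter_upwards [hD₁, hD₂, eventually_ge_atTop 1] with l h1 h2 hl1 b x hb
  have hl : 0 < l := by linarith
  obtain ⟨J, hJ, hcard, hsum⟩ := h2 x
  refine ⟨J, hJ, ?_⟩
  have hsl : 0 < √l := Real.sqrt_pos.mpr hl
  have hpi2 : (2 * Real.pi)⁻¹ ≤ 1 := inv_le_one_of_one_le₀ (by linarith [Real.pi_gt_three])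
  have hpi2' : 0 < (2 * Real.pi)⁻¹ := by positivity
  -- The worst of the three errors after summation over about `l²` indices and division by `√l`:
  -- stationary phase gives `l⁻¹ · l^{-3/5} · l² / √l = l · l^{-1/10} / √l · l^{-1/2}`, that is
  -- `l^{-1/10}`. The Fourier approximation gives `l^{-1/2}` and the Riemann sum `l⁻¹`.
  set w := l ^ (-(1 / 10) : ℝ) with hw
  have hw1 : 1 / √l ≤ w := by
    rw [Real.sqrt_eq_rpow, one_div, ← Real.rpow_neg hl.le]
    exact Real.rpow_le_rpow_of_exponent_le hl1 (by norm_num)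
  have hw2 : 1 / l ≤ w := by
    rw [one_div, ← Real.rpow_neg_one]
    exact Real.rpow_le_rpow_of_exponent_le hl1 (by norm_num)
  have hw3 : l ^ (-(3 / 5) : ℝ) / l = w * √l / l ^ 2 := by
    have e1 : l ^ (-(3 / 5) : ℝ) * l = w * √l := by
      rw [hw, Real.sqrt_eq_rpow, ← Real.rpow_add_one hl.ne', ← Real.rpow_add hl]
      norm_num
    rw [← e1]
    field_simp
  set g : ℤ → ℝ := fun j => profileAmp c₃ c₄ ((x - j) / l ^ 2) *
    |Real.cos (l * profilePhase c₃ ((x - j) / l ^ 2) - Real.pi / 4)| with hg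
  have hpt : ∀ j ∈ J, |‖b j‖ - (2 * Real.pi)⁻¹ * (g j / (l * √l))| ≤
      (D + D₁) * (w * √l / l ^ 2) := by
    intro j hj
    have e1 := (abs_norm_sub_norm_le _ _).trans (hb.approx j)
    have e2 := h1 _ ((hJ j).mp hj)
    set I := ‖oscInt c₃ c₄ l ((x - j) / l ^ 2)‖
    have e3 : ‖(2 * Real.pi * l : ℂ)⁻¹ * oscInt c₃ c₄ l ((x - j) / l ^ 2)‖ =
        (2 * Real.pi)⁻¹ * (I / l) := by
      have : (2 * Real.pi * l : ℂ) = ((2 * Real.pi * l : ℝ) : ℂ) := by push_cast; rfl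
      rw [norm_mul, this, norm_inv, Complex.norm_real, Real.norm_of_nonneg (by positivity)]
      field_simp
      rfl
    rw [e3] at e1
    have e4 : |(2 * Real.pi)⁻¹ * (I / l) - (2 * Real.pi)⁻¹ * (g j / (l * √l))| ≤
        D₁ * (w * √l / l ^ 2) := by
      rw [show (2 * Real.pi)⁻¹ * (I / l) - (2 * Real.pi)⁻¹ * (g j / (l * √l)) =
        (2 * Real.pi)⁻¹ * ((I - g j / √l) / l) by field_simp, abs_mul, abs_of_pos hpi2', abs_div,
        abs_of_pos hl, ← hw3]
      refine (mul_le_of_le_one_left (by positivity) hpi2).trans ?_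
      rw [← mul_div_assoc]
      gcongr
    have e5 : D / l ^ 2 ≤ D * (w * √l / l ^ 2) := by
      rw [← mul_div_assoc]
      gcongr
      refine le_mul_of_one_le_right hD ?_
      rwa [← div_le_iff₀ hsl]
    refine (abs_sub_le _ ((2 * Real.pi)⁻¹ * (I / l)) _).trans ?_
    linarith
  have hsum1 : |∑ j ∈ J, ‖b j‖ - (2 * Real.pi)⁻¹ * ((∑ j ∈ J, g j) / (l * √l))| ≤
      J.card * ((D + D₁) * (w * √l / l ^ 2)) := by
    rw [Finset.sum_div, Finset.mul_sum, ← Finset.sum_sub_distrib]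
    refine (Finset.abs_sum_le_sum_abs _ _).trans ((Finset.sum_le_sum hpt).trans ?_)
    rw [Finset.sum_const, nsmul_eq_mul]
  have hsum2 : |(∑ j ∈ J, ‖b j‖) / √l - (2 * Real.pi)⁻¹ * ((∑ j ∈ J, g j) / l ^ 2)| ≤
      (M - e + 1) * (D + D₁) * w := by
    have e1 : (∑ j ∈ J, ‖b j‖) / √l - (2 * Real.pi)⁻¹ * ((∑ j ∈ J, g j) / l ^ 2) =
        (∑ j ∈ J, ‖b j‖ - (2 * Real.pi)⁻¹ * ((∑ j ∈ J, g j) / (l * √l))) / √l := by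
      have : l ^ 2 = l * √l * √l := by rw [mul_assoc, Real.mul_self_sqrt hl.le, sq]
      rw [this]
      field_simp
    rw [e1, abs_div, abs_of_pos hsl, div_le_iff₀ hsl]
    refine hsum1.trans ?_
    calc _ = (J.card / l ^ 2) * ((D + D₁) * (w * √l)) := by ring
      _ ≤ (M - e + 1) * ((D + D₁) * (w * √l)) := by gcongr
      _ = _ := by ring
  have hsum3 : |(2 * Real.pi)⁻¹ * ((∑ j ∈ J, g j) / l ^ 2) -
      1 / Real.pi ^ 2 * ∫ z in e..M, profileAmp c₃ c₄ z| ≤ D₂ * w := by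
    rw [show (2 * Real.pi)⁻¹ * ((∑ j ∈ J, g j) / l ^ 2) -
      1 / Real.pi ^ 2 * ∫ z in e..M, profileAmp c₃ c₄ z = (2 * Real.pi)⁻¹ *
      ((∑ j ∈ J, g j) / l ^ 2 - 2 / Real.pi * ∫ z in e..M, profileAmp c₃ c₄ z) by
        field_simp, abs_mul, abs_of_pos hpi2']
    refine (mul_le_of_le_one_left (abs_nonneg _) hpi2).trans (hsum.trans ?_)
    rw [div_eq_mul_one_div]
    gcongr
  refine (abs_sub_le _ _ _).trans ((add_le_add hsum2 hsum3).trans (le_of_eq ?_))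
  ring

/-- The contribution of everything but the oscillating region. -/
theorem exists_sum_rest_le {c₃ c₄ D : ℝ} (hc₃ : 0 < c₃) (hc₄ : 0 < c₄) (hD : 0 ≤ D)
    {e M : ℝ} (he : 0 < e) (heM : e < M) :
    ∃ K, 0 ≤ K ∧ ∀ᶠ l : ℝ in atTop, ∀ (b : ℤ →₀ ℂ) (x : ℝ), ScaleBounds c₃ c₄ D b l x →
      ∀ J : Finset ℤ, (∀ j : ℤ, j ∈ J ↔ (x - j) / l ^ 2 ∈ Icc e M) →
      (∑ j ∈ b.support, ‖b j‖) / √l - (∑ j ∈ J, ‖b j‖) / √l ≤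
        K / √l + √(3 * e * D) + √(4 / M * D) := by
  have hpi := Real.pi_pos
  have hMe : 0 < M - e := by linarith
  have hM : 0 < M := by linarith
  refine ⟨(M - e + 1) * (10 / e + D), by positivity, ?_⟩
  filter_upwards [eventually_ge_atTop 1, eventually_ge_atTop (1 / (M - e)),
    eventually_ge_atTop (1 / e), eventually_ge_atTop (1 / M)] with l hl1 hlM hle hlM' b x hb J hJ
  have hl : 0 < l := by linarith
  have hsl : 0 < √l := Real.sqrt_pos.mpr hl
  have hη : 0 < (l ^ 2)⁻¹ := by positivity
  have hη1 : (l ^ 2)⁻¹ ≤ l⁻¹ := by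
    gcongr
    nlinarith
  have hη2 : (l ^ 2)⁻¹ ≤ M - e := hη1.trans (by rwa [inv_le_comm₀ hl hMe, ← one_div])
  have hη3 : (l ^ 2)⁻¹ ≤ 1 := inv_le_one_of_one_le₀ (by nlinarith)
  have hη4 : (l ^ 2)⁻¹ ≤ e := hη1.trans (by rwa [inv_le_comm₀ hl he, ← one_div])
  have hη5 : (l ^ 2)⁻¹ ≤ M := hη1.trans (by rwa [inv_le_comm₀ hl hM, ← one_div])
  obtain ⟨J₁, hJ₁, hcard₁, -⟩ := exists_finset_riemann_sum (e := -M) (M := -e) hη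
    (by linarith) x
  obtain ⟨J₂, hJ₂, hcard₂, -⟩ := exists_finset_riemann_sum (e := -e) (M := e) hη
    (by linarith) x
  have hcover := sum_norm_support_le (b := b) hJ (fun j => by rw [hJ₁, div_eq_mul_inv])
    (fun j => by rw [hJ₂, div_eq_mul_inv])
  -- No stationary point here: each of the `O(l²)` entries is `O(l⁻²)`, so the sum stays bounded.
  have hleft : ∑ j ∈ J₁, ‖b j‖ ≤ (M - e + 1) * (10 / e + D) := by
    have hpt : ∀ j ∈ J₁, ‖b j‖ ≤ (10 / e + D) * (l ^ 2)⁻¹ := by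
      intro j hj
      have hz := ((hJ₁ j).mp hj).2
      rw [← div_eq_mul_inv] at hz
      have e1 := norm_oscInt_le_of_neg hc₃ hc₄ hl (z := (x - j) / l ^ 2) (by linarith)
      have e2 : 10 / (l * -((x - j) / l ^ 2)) ≤ 10 / (l * e) := by
        gcongr
        linarith
      have e3 : ‖(2 * Real.pi * l : ℂ)⁻¹ * oscInt c₃ c₄ l ((x - j) / l ^ 2)‖ ≤
          10 / e * (l ^ 2)⁻¹ := by
        have h1 : (2 * Real.pi * l : ℂ) = ((2 * Real.pi * l : ℝ) : ℂ) := by push_cast; rfl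
        rw [norm_mul, h1, norm_inv, Complex.norm_real, Real.norm_of_nonneg (by positivity)]
        have h2 : (2 * Real.pi * l)⁻¹ ≤ l⁻¹ := by
          gcongr
          nlinarith [Real.pi_gt_three]
        calc _ ≤ l⁻¹ * (10 / (l * e)) := by
              refine mul_le_mul h2 (e1.trans e2) (norm_nonneg _) (by positivity)
          _ = _ := by field_simp
      have e4 := hb.approx j
      have e5 := norm_le_norm_add_norm_sub' (b j)
        ((2 * Real.pi * l : ℂ)⁻¹ * oscInt c₃ c₄ l ((x - j) / l ^ 2))
      rw [div_eq_mul_inv D] at e4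
      linarith
    refine (Finset.sum_le_sum hpt).trans ?_
    rw [Finset.sum_const, nsmul_eq_mul]
    calc _ = ((l ^ 2)⁻¹ * J₁.card) * (10 / e + D) := by ring
      _ ≤ (M - e + 1) * (10 / e + D) := by
        gcongr
        linarith
  -- The stationary points merge as `z → 0`, so Cauchy–Schwarz replaces pointwise asymptotics. The
  -- count is at most `(2e + l⁻²) l² ≤ 3e l²`.
  have hnear : ∑ j ∈ J₂, ‖b j‖ ≤ √(3 * e * D) * √l := by
    refine (sum_le_sqrt_card_mul_sqrt J₂ fun j => ‖b j‖).trans ?_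
    rw [← Real.sqrt_mul (by positivity), ← Real.sqrt_mul (by positivity)]
    apply Real.sqrt_le_sqrt
    have h1 : (J₂.card : ℝ) ≤ 3 * e * l ^ 2 := by
      have h2 : (l ^ 2)⁻¹ * J₂.card ≤ 3 * e := by linarith
      rwa [← div_eq_inv_mul, div_le_iff₀ (by positivity)] at h2
    have h2 := (sum_sq_le_sum_support b (fun _ => 1) (fun _ => zero_le_one) J₂).trans
      (by simpa using hb.sum_sq)
    simp only [one_mul] at h2
    calc _ ≤ 3 * e * l ^ 2 * (D / l) := by gcongr
      _ = _ := by field_simp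
  -- Here `|j - x| ≥ Ml²`, and `√(4 / (Ml²)) · √(Dl³)` is exactly the claimed bound.
  have hfar : ∑ j ∈ b.support.filter (fun j : ℤ => M ≤ |(x - j) / l ^ 2|), ‖b j‖ ≤
      √(4 / M * D) * √l := by
    have hT : 1 ≤ M * l ^ 2 := by
      rwa [inv_le_iff_one_le_mul₀ (by positivity)] at hη5
    refine (sum_norm_far_le hT _ (fun j hj => ?_) hb.sum_weighted).trans ?_
    · have h1 := (Finset.mem_filter.mp hj).2
      rwa [abs_div, abs_of_pos (by positivity : 0 < l ^ 2), le_div_iff₀ (by positivity),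
        abs_sub_comm] at h1
    · rw [← Real.sqrt_mul (by positivity), ← Real.sqrt_mul (by positivity)]
      apply Real.sqrt_le_sqrt
      apply le_of_eq
      field_simp
  rw [← sub_div, div_le_iff₀ hsl]
  have h1 : (K : ℝ) → K / √l * √l = K := fun K => div_mul_cancel₀ K hsl.ne'
  rw [add_mul, add_mul, h1]
  linarith

theorem tendsto_sum_norm_convPow {a : ℤ →₀ ℂ} {α c₃ c₄ : ℝ}
    (ha : DispersiveAssumption a α c₃ c₄) (hc₃ : 0 < c₃) :
    Tendsto (fun n : ℕ => 1 / (n : ℝ) ^ (1 / 8 : ℝ) *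
        ∑ j ∈ (convPow a n).support, ‖convPow a n j‖) atTop
      (𝓝 (8 * Real.Gamma (11 / 8) / (√3 * Real.pi ^ (3 / 2 : ℝ)) *
        (c₃ ^ (1 / 2 : ℝ) / c₄ ^ (3 / 8 : ℝ)))) := by
  have hc₄ := ha.c₄_pos
  obtain ⟨D, hD, hb⟩ := ha.exists_scaleBounds
  rw [← integral_profileAmp hc₃ hc₄]
  have hl : Tendsto (fun n : ℕ => (n : ℝ) ^ (1 / 4 : ℝ)) atTop atTop :=
    (tendsto_rpow_atTop (by norm_num)).comp tendsto_natCast_atTop_atTop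
  rw [Metric.tendsto_nhds]
  intro ε hε
  have hlim1 : Tendsto (fun M : ℝ => √(3 * M⁻¹ * D) + √(4 / M * D) +
      |1 / Real.pi ^ 2 * (∫ z in M⁻¹..M, profileAmp c₃ c₄ z) -
        1 / Real.pi ^ 2 * ∫ z in Ioi 0, profileAmp c₃ c₄ z|) atTop (𝓝 0) := by
    have t1 : Tendsto (fun M : ℝ => √(3 * M⁻¹ * D)) atTop (𝓝 0) := by
      have := ((tendsto_inv_atTop_zero.const_mul (3 : ℝ)).mul_const D).sqrt
      simpa using this
    have t2 : Tendsto (fun M : ℝ => √(4 / M * D)) atTop (𝓝 0) := by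
      have := ((tendsto_inv_atTop_zero.const_mul (4 : ℝ)).mul_const D).sqrt
      simpa [div_eq_mul_inv] using this
    have t3 := (((tendsto_integral_profileAmp hc₃ hc₄).const_mul (1 / Real.pi ^ 2)).sub_const
      (1 / Real.pi ^ 2 * ∫ z in Ioi 0, profileAmp c₃ c₄ z)).abs
    rw [sub_self, abs_zero] at t3
    simpa using (t1.add t2).add t3
  -- `M` is fixed before `n`, since the constants `K₁` and `K₂` obtained below depend on it; `e =
  -- M⁻¹` leaves a single cutoff parameter.
  obtain ⟨M, hMlim, hM1⟩ :=
    ((hlim1.eventually_lt_const (half_pos hε)).and (eventually_gt_atTop 1)).exists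
  have hM0 : 0 < M := by linarith
  have he : 0 < M⁻¹ := by positivity
  have heM : M⁻¹ < M := (inv_lt_one_of_one_lt₀ hM1).trans hM1
  obtain ⟨K₁, hK₁0, hK₁⟩ := exists_sum_middle_sub_le hc₃ hc₄ hD he heM
  obtain ⟨K₂, hK₂0, hK₂⟩ := exists_sum_rest_le hc₃ hc₄ hD he heM
  have hlim2 : Tendsto (fun l : ℝ => K₁ * l ^ (-(1 / 10) : ℝ) + K₂ / √l) atTop (𝓝 0) := by
    have t1 := (tendsto_rpow_neg_atTop (y := 1 / 10) (by norm_num)).const_mul K₁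
    have t2 := Real.tendsto_sqrt_atTop.const_div_atTop K₂
    simpa using t1.add t2
  have hev := hl.eventually
    ((hK₁.and hK₂).and (hlim2.eventually_lt_const (half_pos hε)))
  filter_upwards [hev, eventually_ge_atTop 2] with n hn hn2
  obtain ⟨⟨h1, h2⟩, h3⟩ := hn
  have hn0 : (0 : ℝ) < n := by exact_mod_cast (by omega : 0 < n)
  set l := (n : ℝ) ^ (1 / 4 : ℝ) with hldef
  have hl0 : 0 < l := Real.rpow_pos_of_pos hn0 _
  have hl4 : l ^ 4 = n := by
    rw [hldef, ← Real.rpow_natCast, ← Real.rpow_mul hn0.le]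
    norm_num
  have hsq : (n : ℝ) ^ (1 / 8 : ℝ) = √l := by
    rw [Real.sqrt_eq_rpow, hldef, ← Real.rpow_mul hn0.le]
    norm_num
  have hscale := hb n l hn2 hl0 hl4
  obtain ⟨J, hJ, hmid⟩ := h1 _ _ hscale
  have hrest := h2 _ _ hscale J hJ
  have hge : (∑ j ∈ J, ‖convPow a n j‖) / √l ≤
      (∑ j ∈ (convPow a n).support, ‖convPow a n j‖) / √l :=
    div_le_div_of_nonneg_right (sum_norm_le_sum_support _ _) (Real.sqrt_nonneg l)
  rw [Real.dist_eq, hsq, one_div_mul_eq_div]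
  set S := (∑ j ∈ (convPow a n).support, ‖convPow a n j‖) / √l
  set T := (∑ j ∈ J, ‖convPow a n j‖) / √l
  have hST : |S - T| ≤ K₂ / √l + √(3 * M⁻¹ * D) + √(4 / M * D) := by
    rw [abs_of_nonneg (by linarith)]
    exact hrest
  have t1 := abs_sub_le S T (1 / Real.pi ^ 2 * ∫ z in Ioi 0, profileAmp c₃ c₄ z)
  have t2 := abs_sub_le T (1 / Real.pi ^ 2 * ∫ z in M⁻¹..M, profileAmp c₃ c₄ z)
    (1 / Real.pi ^ 2 * ∫ z in Ioi 0, profileAmp c₃ c₄ z)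
  linarith

end

theorem corollary2 (a : ℤ →₀ ℂ) (α c₃ c₄ : ℝ) (ha : DispersiveAssumption a α c₃ c₄)
    (hc₃ : 0 < c₃) :
    (∀ n : ℕ, Summable fun j : ℤ => ‖greenFunction a n j‖) ∧
    Filter.Tendsto
      (fun n : ℕ => 1 / (n : ℝ) ^ (1 / 8 : ℝ) * ∑' j : ℤ, ‖greenFunction a n j‖)
      Filter.atTop
      (nhds (8 * Real.Gamma (11 / 8) / (√3 * Real.pi ^ (3 / 2 : ℝ)) *
        (c₃ ^ (1 / 2 : ℝ) / c₄ ^ (3 / 8 : ℝ)))) ∧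
    Filter.Tendsto
      (fun n : ℕ => 1 / (n : ℝ) ^ (1 / 8 : ℝ) * ‖laurentLinfty a ^ n‖)
      Filter.atTop
      (nhds (8 * Real.Gamma (11 / 8) / (√3 * Real.pi ^ (3 / 2 : ℝ)) *
        (c₃ ^ (1 / 2 : ℝ) / c₄ ^ (3 / 8 : ℝ)))) := by
  have h := tendsto_sum_norm_convPow ha hc₃
  refine ⟨summable_norm_greenFunction a, ?_, ?_⟩
  · simpa only [tsum_norm_greenFunction] using h
  · simpa only [laurentLinfty_pow, norm_laurentLinfty] using h
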